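/- Let $\mathbb{K}$ be a field of characteristic $0$, $R=\mathbb{K}[q^{\pm 1/2}]$, $p=q^{1/2}-1$ and $\mathbb{K}_1=R/pR$. Let $r,n\ge 0$, $m=r+n$, let $\Lambda=(\lambda_{ij})\in M_m(\mathbb{Z})$ be skew-symmetric and let $\widetilde B=(b_{ij})\in M_{m,r}(\mathbb{Z})$ be such that $(\Lambda,\widetilde B)$ is a compatible pair: there are positive integers $d_1,\dots,d_r$ with $\sum_{k=1}^m b_{kj}\lambda_{ki}=\delta_{ij}d_j$ for $1\le j\le r$, $1\le i\le m$. Let $\mathcal{T}_q(\Lambda)$ be the based quantum torus, i.e. the $R$-algebra with $R$-basis $\{X^e\mid e\in\mathbb{Z}^m\}$ and multiplication $X^eX^f=q^{\Lambda(e,f)/2}X^{e+f}$, where $\Lambda(e,f)=e^{t}\Lambda f$, and let $\mathcal{F}$ be its skew field of fractions. The initial quantum seed $(M,\widetilde B)$ has $M(c)=X^c$; write $X_i=X^{e_i}$. In general a quantum seed has a commutation matrix $\Lambda'$, an exchange matrix $\widetilde B'=(b'_{ij})$ and a toric frame $M'\colon\mathbb{Z}^m\to\mathcal{F}$, $M'(c)=q^{-\frac12\sum_{i<j}c_ic_j\lambda'_{ij}}M'(e_1)^{c_1}\cdots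 M'(e_m)^{c_m}$. Its mutation in direction $k\in\{1,\dots,r\}$ replaces $M'(e_k)$ by $$M'\Big(-e_k+\sum_i[b'_{ik}]_+e_i\Big)+M'\Big(-e_k+\sum_i[-b'_{ik}]_+e_i\Big),$$ keeps $M'(e_i)$ for $i\ne k$, replaces $\widetilde B'$ by its usual matrix mutation $\mu_k(\widetilde B')$, and replaces $\Lambda'$ by $E^t\Lambda' E$, where $E$ is the identity matrix with the $k$-th column replaced by $-e_k+\sum_{i\neq k}[-b'_{ik}]_+e_i$. Here $[b]_+=\max(b,0)$. Let $\mathcal{T}_qM'\subseteq\mathcal{F}$ be the $R$-subalgebra generated by the $M'(e_i)^{\pm1}$, $1\le i\le m$. Let $M_k$ be the toric frame of $\mu_k(M,\widetilde B)$, let $\mathcal{S}$ be the set of quantum seeds obtained from $(M,\widetilde B)$ by finite sequences of mutations, and let $$\mathcal{U}_q(\Lambda,\widetilde B):=\mathcal{T}_qM\cap\mathcal{T}_qM_1\cap\cdots\cap\mathcal{T}_qM_r$$ be the upper quantum cluster algebra, with inclusion $j\colon\mathcal{U}_q(\Lambda,\widetilde B)\to\mathcal{T}_qM$. Let $\mathcal{A}(\widetilde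 B)\subseteq\mathbb{K}(X_1,\dots,X_m)$ be the commutative cluster algebra with initial cluster $(X_1,\dots,X_m)$, i.e. the $\mathbb{K}$-subalgebra generated by all cluster variables, the frozen variables $X_{r+1},\dots,X_m$ and their inverses. Let $\mathcal{U}(\widetilde B)\subseteq\mathbb{K}(X_1,\dots,X_m)$ be the upper cluster algebra, i.e. the intersection of the Laurent polynomial rings $\mathbb{K}[x_1^{\pm1},\dots,x_m^{\pm1}]$ over all seeds (with extended clusters $(x_1,\dots,x_m)$) that are mutation equivalent to the initial one. Then $\mathcal{U}_q(\Lambda,\widetilde B)=\bigcap_{(M',\widetilde B')\in\mathcal{S}}\mathcal{T}_qM'$, and the following hold. (i) The map $\mathbb{K}_1\otimes_R j\colon\mathbb{K}_1\otimes_R\mathcal{U}_q(\Lambda,\widetilde B)\to\mathbb{K}_1\otimes_R\mathcal{T}_qM$ is injective. (ii) There is an isomorphism of $\mathbb{K}$-algebras $\mathbb{K}_1\otimes_R\mathcal{T}_qM\cong\mathbb{K}[X_1^{\pm1},\dots,X_m^{\pm1}]$ with $1\otimes X_i\mapsto X_i$ for all $i$ (it is unique), and under this identification $$\mathcal{A}(\widetilde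 B)\subseteq\operatorname{Im}(\mathbb{K}_1\otimes_R j)\subseteq\mathcal{U}(\widetilde B).$$ -/

import Mathlib

open scoped TensorProduct nonZeroDivisors

noncomputable section

namespace QCA

/-! ### The ground ring `R = K[q^{±1/2}]` -/

/-- `R = K[q^{±1/2}]`, where the variable `T` stands for `q^{1/2}`. -/
abbrev QRing (K : Type*) [Field K] : Type _ := LaurentPolynomial K

/-- The power `q^{a/2}` in `R`. -/
def qHalf (K : Type*) [Field K] (a : ℤ) : QRing K := LaurentPolynomial.T a

/-- The ring `K₁ = R / pR` with `p = q^{1/2} - 1`. -/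
abbrev K₁ (K : Type*) [Field K] : Type _ := QRing K ⧸ Ideal.span {qHalf K 1 - 1}

/-! ### The based quantum torus -/

/-- The bilinear form `Λ(e, f) = eᵀ Λ f` on `ℤ^m`. -/
def form {m : ℕ} (Λ : Matrix (Fin m) (Fin m) ℤ) (e f : Fin m → ℤ) : ℤ := e ⬝ᵥ (Λ.mulVec f)

/-- The based quantum torus `T_q(Λ)`: the free `R`-module with basis `X^e`, `e ∈ ℤ^m`, and with
multiplication `X^e X^f = q^{Λ(e,f)/2} X^{e+f}`. -/
def QuantumTorus (K : Type*) [Field K] {m : ℕ} (_Λ : Matrix (Fin m) (Fin m) ℤ) : Type _ :=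
  (Fin m → ℤ) →₀ QRing K

namespace QuantumTorus

variable {K : Type*} [Field K] {m : ℕ} {Λ : Matrix (Fin m) (Fin m) ℤ}

instance : AddCommGroup (QuantumTorus K Λ) :=
  inferInstanceAs (AddCommGroup ((Fin m → ℤ) →₀ QRing K))

instance : Module (QRing K) (QuantumTorus K Λ) :=
  inferInstanceAs (Module (QRing K) ((Fin m → ℤ) →₀ QRing K))

/-- The scalar multiple `a X^e` of a basis element. -/
def mono (Λ : Matrix (Fin m) (Fin m) ℤ) (e : Fin m → ℤ) (a : QRing K) : QuantumTorus K Λ :=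
  Finsupp.single e a

/-- The multiplication of the quantum torus, as an `R`-bilinear map. -/
def mulL (K : Type*) [Field K] (Λ : Matrix (Fin m) (Fin m) ℤ) :
    ((Fin m → ℤ) →₀ QRing K) →ₗ[QRing K] ((Fin m → ℤ) →₀ QRing K) →ₗ[QRing K]
      ((Fin m → ℤ) →₀ QRing K) :=
  Finsupp.linearCombination (QRing K) fun e =>
    Finsupp.linearCombination (QRing K) fun f => Finsupp.single (e + f) (qHalf K (form Λ e f))

instance : Mul (QuantumTorus K Λ) := ⟨fun x y => mulL K Λ x y⟩

instance : One (QuantumTorus K Λ) := ⟨mono Λ 0 1⟩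

theorem mul_eq (x y : QuantumTorus K Λ) : x * y = mulL K Λ x y := rfl

theorem one_eq : (1 : QuantumTorus K Λ) = mono Λ 0 1 := rfl

theorem mono_mul_mono (e f : Fin m → ℤ) (a b : QRing K) :
    mono Λ e a * mono Λ f b = mono Λ (e + f) (a * b * qHalf K (form Λ e f)) := by
  change mulL K Λ (Finsupp.single e a) (Finsupp.single f b) =
    Finsupp.single (e + f) (a * b * qHalf K (form Λ e f))
  rw [mulL, Finsupp.linearCombination_single, LinearMap.smul_apply, Finsupp.linearCombination_single]
  rw [Finsupp.smul_single, Finsupp.smul_single, smul_eq_mul, smul_eq_mul, mul_assoc]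

@[elab_as_elim]
theorem induct {P : QuantumTorus K Λ → Prop} (x : QuantumTorus K Λ) (h0 : P 0)
    (ha : ∀ x y, P x → P y → P (x + y)) (h1 : ∀ e a, P (mono Λ e a)) : P x :=
  Finsupp.induction_linear (motive := P) x h0 ha h1

theorem add_mul' (x y z : QuantumTorus K Λ) : (x + y) * z = x * z + y * z :=
  LinearMap.map_add₂ (mulL K Λ) x y z

theorem mul_add' (x y z : QuantumTorus K Λ) : x * (y + z) = x * y + x * z :=
  map_add (mulL K Λ x) y z

theorem zero_mul' (x : QuantumTorus K Λ) : 0 * x = 0 := LinearMap.map_zero₂ (mulL K Λ) x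

theorem mul_zero' (x : QuantumTorus K Λ) : x * 0 = 0 := map_zero (mulL K Λ x)

theorem form_add_left (e f g : Fin m → ℤ) : form Λ (e + f) g = form Λ e g + form Λ f g := by
  simp [form, add_dotProduct]

theorem form_add_right (e f g : Fin m → ℤ) : form Λ e (f + g) = form Λ e f + form Λ e g := by
  simp [form, Matrix.mulVec_add, dotProduct_add]

theorem form_zero_left (e : Fin m → ℤ) : form Λ 0 e = 0 := by simp [form]

theorem form_zero_right (e : Fin m → ℤ) : form Λ e 0 = 0 := by simp [form]

theorem qHalf_add (a b : ℤ) : qHalf K (a + b) = qHalf K a * qHalf K b := LaurentPolynomial.T_add a b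

theorem qHalf_zero : qHalf K 0 = 1 := LaurentPolynomial.T_zero

theorem mul_assoc' (x y z : QuantumTorus K Λ) : x * y * z = x * (y * z) := by
  induction x using induct with
  | h0 => simp only [zero_mul']
  | ha x x' hx hx' => simp only [add_mul', hx, hx']
  | h1 e a =>
    induction y using induct with
    | h0 => simp only [zero_mul', mul_zero']
    | ha y y' hy hy' => simp only [add_mul', mul_add', hy, hy']
    | h1 f b =>
      induction z using induct with
      | h0 => simp only [mul_zero']
      | ha z z' hz hz' => simp only [mul_add', hz, hz']
      | h1 g c =>
        simp only [mono_mul_mono, form_add_left, form_add_right, qHalf_add, add_assoc]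
        congr 1
        ring

instance : Ring (QuantumTorus K Λ) :=
  { (inferInstance : AddCommGroup (QuantumTorus K Λ)) with
    mul := (· * ·)
    one := 1
    left_distrib := mul_add'
    right_distrib := add_mul'
    zero_mul := zero_mul'
    mul_zero := mul_zero'
    mul_assoc := mul_assoc'
    one_mul := fun x => by
      induction x using induct with
      | h0 => exact mul_zero' _
      | ha x y hx hy => rw [mul_add', hx, hy]
      | h1 e a => rw [one_eq, mono_mul_mono, form_zero_left, qHalf_zero, zero_add, one_mul, mul_one]
    mul_one := fun x => by
      induction x using induct with
      | h0 => exact zero_mul' _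
      | ha x y hx hy => rw [add_mul', hx, hy]
      | h1 e a =>
        rw [one_eq, mono_mul_mono, form_zero_right, qHalf_zero, add_zero, mul_one, mul_one] }

instance : Algebra (QRing K) (QuantumTorus K Λ) :=
  Algebra.ofModule (fun r x y => LinearMap.map_smul₂ (mulL K Λ) r x y)
    (fun r x y => map_smul (mulL K Λ x) r y)

/-- The basis element `X^e`. -/
def X (K : Type*) [Field K] (Λ : Matrix (Fin m) (Fin m) ℤ) (e : Fin m → ℤ) : QuantumTorus K Λ :=
  mono Λ e 1

theorem X_mul_X (e f : Fin m → ℤ) :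
    X K Λ e * X K Λ f = qHalf K (form Λ e f) • X K Λ (e + f) := by
  rw [X, X, mono_mul_mono, X]
  refine Eq.trans ?_ (Finsupp.smul_single (qHalf K (form Λ e f)) (e + f) (1 : QRing K)).symm
  rw [one_mul, one_mul, smul_eq_mul, mul_one]
  rfl

theorem mulL_apply (x y : (Fin m → ℤ) →₀ QRing K) (g : Fin m → ℤ) :
    mulL K Λ x y g = ∑ e ∈ x.support, ∑ f ∈ y.support,
      if e + f = g then x e * (y f * qHalf K (form Λ e f)) else 0 := by
  classical
  rw [mulL, Finsupp.linearCombination_apply, Finsupp.sum, LinearMap.sum_apply,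
    Finsupp.finsetSum_apply]
  refine Finset.sum_congr rfl fun e _ => ?_
  rw [LinearMap.smul_apply, Finsupp.smul_apply, Finsupp.linearCombination_apply, Finsupp.sum,
    Finsupp.finsetSum_apply, smul_eq_mul, Finset.mul_sum]
  refine Finset.sum_congr rfl fun f _ => ?_
  rw [Finsupp.smul_apply, Finsupp.single_apply]
  split_ifs <;> simp

theorem qHalf_ne_zero (a : ℤ) : qHalf K a ≠ 0 := by
  intro h
  have h1 : qHalf K a * qHalf K (-a) = 1 := by rw [← qHalf_add, add_neg_cancel, qHalf_zero]
  rw [h, zero_mul] at h1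
  exact zero_ne_one h1

theorem mulL_ne_zero {x y : (Fin m → ℤ) →₀ QRing K} (hx : x ≠ 0) (hy : y ≠ 0) :
    mulL K Λ x y ≠ 0 := by
  obtain ⟨e, he, f, hf, hu⟩ := UniqueSums.uniqueAdd_of_nonempty
    (Finsupp.support_nonempty_iff.2 hx) (Finsupp.support_nonempty_iff.2 hy)
  intro h
  have h1 := mulL_apply (Λ := Λ) x y (e + f)
  rw [h, Finset.sum_eq_single e, Finset.sum_eq_single f, if_pos rfl] at h1
  · have h2 := mul_ne_zero (Finsupp.mem_support_iff.1 he)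
      (mul_ne_zero (Finsupp.mem_support_iff.1 hf) (qHalf_ne_zero (K := K) (form Λ e f)))
    exact h2 h1.symm
  · intro f' hf' hne
    exact if_neg fun h' => hne (hu he hf' h').2
  · exact fun h' => absurd hf h'
  · intro e' he' hne
    exact Finset.sum_eq_zero fun f' hf' => if_neg fun h' => hne (hu he' hf' h').1
  · exact fun h' => absurd he h'

instance : NoZeroDivisors (QuantumTorus K Λ) where
  eq_zero_or_eq_zero_of_mul_eq_zero := by
    intro x y h
    by_contra! h'
    exact mulL_ne_zero (Λ := Λ) h'.1 h'.2 h

instance : Nontrivial (QuantumTorus K Λ) :=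
  inferInstanceAs (Nontrivial ((Fin m → ℤ) →₀ QRing K))

/-- The exponents in the box `[-N, N]^m`. -/
def box (m N : ℕ) : Finset (Fin m → ℤ) := Fintype.piFinset fun _ => Finset.Icc (-N : ℤ) N

theorem card_box (m N : ℕ) : (box m N).card = (2 * N + 1) ^ m := by
  rw [box, Fintype.card_piFinset]
  simp only [Int.card_Icc, Finset.prod_const, Finset.card_univ, Fintype.card_fin]
  congr 1
  omega

theorem mem_box {N : ℕ} {e : Fin m → ℤ} : e ∈ box m N ↔ ∀ i, -(N : ℤ) ≤ e i ∧ e i ≤ N := by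
  simp [box]

theorem exists_box (s : Finset (Fin m → ℤ)) : ∃ c : ℕ, s ⊆ box m c := by
  refine ⟨∑ e ∈ s, ∑ i, (e i).natAbs, fun e he => mem_box.2 fun i => ?_⟩
  have h1 : (e i).natAbs ≤ ∑ i, (e i).natAbs :=
    Finset.single_le_sum (f := fun i => (e i).natAbs) (fun _ _ => Nat.zero_le _) (Finset.mem_univ i)
  have h2 : ∑ i, (e i).natAbs ≤ ∑ e ∈ s, ∑ i, (e i).natAbs :=
    Finset.single_le_sum (f := fun e : Fin m → ℤ => ∑ i, (e i).natAbs)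
      (fun _ _ => Nat.zero_le _) he
  omega

theorem mulL_mem_supported {N c : ℕ} {x y : (Fin m → ℤ) →₀ QRing K}
    (hx : x ∈ Finsupp.supported (QRing K) (QRing K) (box m N : Set (Fin m → ℤ)))
    (hy : y.support ⊆ box m c) :
    mulL K Λ x y ∈ Finsupp.supported (QRing K) (QRing K) (box m (N + c) : Set (Fin m → ℤ)) := by
  rw [Finsupp.mem_supported] at hx ⊢
  intro g hg
  have hg' : mulL K Λ x y g ≠ 0 := Finsupp.mem_support_iff.1 hg
  rw [mulL_apply] at hg'
  obtain ⟨e, he, h1⟩ := Finset.exists_ne_zero_of_sum_ne_zero hg'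
  obtain ⟨f, hf, h2⟩ := Finset.exists_ne_zero_of_sum_ne_zero h1
  have h3 : e + f = g := by
    by_contra h
    exact h2 (if_neg h)
  have he' := mem_box.1 (hx he)
  have hf' := mem_box.1 (hy hf)
  refine mem_box.2 fun i => ?_
  have := he' i
  have := hf' i
  rw [← h3, Pi.add_apply]
  push_cast
  omega

theorem growth (m c : ℕ) : ∃ N : ℕ, (2 * (N + c) + 1) ^ m < 2 * (2 * N + 1) ^ m := by
  have h1 : Filter.Tendsto (fun N : ℕ => (1 + (2 * c : ℝ) / (2 * N + 1)) ^ m) Filter.atTop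
      (nhds ((1 + 0) ^ m)) := by
    refine (Filter.Tendsto.const_add _ ?_).pow _
    refine Filter.Tendsto.const_div_atTop ?_ _
    refine Filter.tendsto_atTop_add_const_right _ _ ?_
    exact tendsto_natCast_atTop_atTop.const_mul_atTop two_pos
  have h2 : ∀ᶠ N : ℕ in Filter.atTop, (1 + (2 * c : ℝ) / (2 * N + 1)) ^ m < 2 :=
    h1.eventually_lt_const (by norm_num)
  obtain ⟨N, hN⟩ := h2.exists
  refine ⟨N, ?_⟩
  have h3 : (0 : ℝ) < (2 * N + 1) := by positivity
  have h4 : (1 + (2 * c : ℝ) / (2 * N + 1)) = (2 * (N + c) + 1) / (2 * N + 1) := by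
    field_simp
    ring
  rw [h4, div_pow, div_lt_iff₀ (by positivity)] at hN
  exact_mod_cast hN

theorem finrank_supported (s : Finset (Fin m → ℤ)) :
    Module.finrank (QRing K) (Finsupp.supported (QRing K) (QRing K) (s : Set (Fin m → ℤ))) =
      s.card := by
  rw [(Finsupp.supportedEquivFinsupp (s : Set (Fin m → ℤ))).finrank_eq]
  simp

theorem ore_condition (r s : (Fin m → ℤ) →₀ QRing K) (hs : s ≠ 0) :
    ∃ a b : (Fin m → ℤ) →₀ QRing K, b ≠ 0 ∧ mulL K Λ b r = mulL K Λ a s := by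
  by_contra! H
  obtain ⟨c, hc⟩ := exists_box (r.support ∪ s.support)
  obtain ⟨N, hN⟩ := growth m c
  have hr' : r.support ⊆ box m c := Finset.union_subset_left hc
  have hs' : s.support ⊆ box m c := Finset.union_subset_right hc
  let V := Finsupp.supported (QRing K) (QRing K) (box m N : Set (Fin m → ℤ))
  let W := Finsupp.supported (QRing K) (QRing K) (box m (N + c) : Set (Fin m → ℤ))
  let φ : (V × V) →ₗ[QRing K] ((Fin m → ℤ) →₀ QRing K) :=
    ((mulL K Λ).flip r ∘ₗ V.subtype).coprod (-((mulL K Λ).flip s ∘ₗ V.subtype))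
  have hφ : ∀ z, φ z ∈ W := by
    rintro ⟨a, b⟩
    have : φ (a, b) = mulL K Λ a r - mulL K Λ b s := by simp [φ, sub_eq_add_neg]
    rw [this]
    exact W.sub_mem (mulL_mem_supported a.2 hr') (mulL_mem_supported b.2 hs')
  have hinj : Function.Injective (φ.codRestrict W hφ) := by
    refine (injective_iff_map_eq_zero _).2 ?_
    rintro ⟨a, b⟩ h'
    have h : φ (a, b) = 0 := congrArg Subtype.val h'
    have h1 : mulL K Λ a r = mulL K Λ b s := by
      have : φ (a, b) = mulL K Λ a r - mulL K Λ b s := by simp [φ, sub_eq_add_neg]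
      rw [this] at h
      exact sub_eq_zero.1 h
    have ha : (a : (Fin m → ℤ) →₀ QRing K) = 0 := by
      by_contra h2
      exact H _ _ h2 h1
    have hb : (b : (Fin m → ℤ) →₀ QRing K) = 0 := by
      by_contra h2
      refine mulL_ne_zero (Λ := Λ) h2 hs ?_
      rw [← h1, ha, LinearMap.map_zero₂]
    exact Prod.ext (Subtype.ext ha) (Subtype.ext hb)
  have e1 := Finsupp.supportedEquivFinsupp (R := QRing K) (M := QRing K)
    (box m N : Set (Fin m → ℤ))
  have e2 := Finsupp.supportedEquivFinsupp (R := QRing K) (M := QRing K)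
    (box m (N + c) : Set (Fin m → ℤ))
  have : Module.Finite (QRing K) V := Module.Finite.equiv e1.symm
  have : Module.Free (QRing K) V := Module.Free.of_equiv e1.symm
  have : Module.Finite (QRing K) W := Module.Finite.equiv e2.symm
  have h := LinearMap.finrank_le_finrank_of_injective hinj
  rw [Module.finrank_prod, finrank_supported, finrank_supported, card_box, card_box] at h
  omega

/-- The nonzero elements of the quantum torus form an Ore set. -/
instance : OreLocalization.OreSet (QuantumTorus K Λ)⁰ :=
  Classical.choice <| OreLocalization.nonempty_oreSet_iff_of_noZeroDivisors.2 fun r s => by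
    obtain ⟨a, b, hb, h⟩ := ore_condition (Λ := Λ) r s.1 (nonZeroDivisors.ne_zero s.2)
    exact ⟨a, ⟨b, mem_nonZeroDivisors_of_ne_zero hb⟩, h⟩

end QuantumTorus

/-- The skew field of fractions `F` of the quantum torus `T_q(Λ)`. -/
abbrev QuantumField (K : Type*) [Field K] {m : ℕ} (Λ : Matrix (Fin m) (Fin m) ℤ) : Type _ :=
  OreLocalization (QuantumTorus K Λ)⁰ (QuantumTorus K Λ)

/-! ### Compatible pairs and matrix mutation

There are `r` mutable and `n` frozen indices and `m = r + n` indices altogether; the mutable ones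
come first. -/

/-- `(Λ, B̃)` is compatible: `Λ` is skew-symmetric and `B̃ᵀ Λ = (D 0)` for a diagonal matrix `D` with
positive diagonal entries. -/
def IsCompatiblePair {r n : ℕ} (Λ : Matrix (Fin (r + n)) (Fin (r + n)) ℤ)
    (B : Matrix (Fin (r + n)) (Fin r) ℤ) : Prop :=
  (∀ i j, Λ i j = -Λ j i) ∧
  ∃ d : Fin r → ℤ, (∀ j, 0 < d j) ∧
    ∀ j i, ∑ k, B k j * Λ k i = if i = Fin.castAdd n j then d j else 0

/-- The mutation `μ_k(B̃)` of an extended exchange matrix. -/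
def mutateMatrix {r n : ℕ} (B : Matrix (Fin (r + n)) (Fin r) ℤ) (k : Fin r) :
    Matrix (Fin (r + n)) (Fin r) ℤ := fun i j =>
  if i = Fin.castAdd n k ∨ j = k then -B i j
  else B i j + (max (B i k) 0 * max (B (Fin.castAdd n k) j) 0
    - max (-B i k) 0 * max (-B (Fin.castAdd n k) j) 0)

/-- The matrix `E` with `μ_k(Λ) = Eᵀ Λ E`. -/
def matrixE {r n : ℕ} (B : Matrix (Fin (r + n)) (Fin r) ℤ) (k : Fin r) :
    Matrix (Fin (r + n)) (Fin (r + n)) ℤ := fun i j =>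
  if j = Fin.castAdd n k then (if i = Fin.castAdd n k then -1 else max (-B i k) 0)
  else if i = j then 1 else 0

/-- The exponent vector `-e_k + ∑ᵢ [bᵢ]₊ eᵢ`. -/
def exchangeExponent {r n : ℕ} (b : Fin (r + n) → ℤ) (k : Fin r) : Fin (r + n) → ℤ := fun i =>
  (if i = Fin.castAdd n k then -1 else 0) + max (b i) 0

/-! ### Quantum seeds -/

/-- The data of a quantum seed in a skew field `F`: the commutation matrix `Λ`, the exchange matrix
`B̃` and the quantum cluster `(M(e₁), …, M(e_m))`, which determine the toric frame `M`. -/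
structure QuantumSeed (F : Type*) (r n : ℕ) where
  /-- the commutation matrix -/
  Λ : Matrix (Fin (r + n)) (Fin (r + n)) ℤ
  /-- the extended exchange matrix -/
  B : Matrix (Fin (r + n)) (Fin r) ℤ
  /-- the quantum cluster -/
  x : Fin (r + n) → F

namespace QuantumSeed

variable (K : Type*) [Field K] {F : Type*} [DivisionRing F] [Algebra (QRing K) F] {r n : ℕ}

/-- The toric frame, normalized such that `M(c) M(d) = q^{Λ(c,d)/2} M(c + d)`:
`M(c) = q^{-(1/2) ∑_{i<j} cᵢ cⱼ λᵢⱼ} x₁^{c₁} ⋯ x_m^{c_m}`. -/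
def frame (s : QuantumSeed F r n) (c : Fin (r + n) → ℤ) : F :=
  qHalf K (-∑ i, ∑ j ∈ Finset.Ioi i, c i * c j * s.Λ i j) •
    (List.ofFn fun i => s.x i ^ c i).prod

/-- The quantum seed mutation `μ_k`. -/
def mutate (s : QuantumSeed F r n) (k : Fin r) : QuantumSeed F r n where
  Λ := (matrixE s.B k).transpose * s.Λ * matrixE s.B k
  B := mutateMatrix s.B k
  x := Function.update s.x (Fin.castAdd n k)
    (s.frame K (exchangeExponent (fun i => s.B i k) k) +
      s.frame K (exchangeExponent (fun i => -s.B i k) k))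

/-- `s'` is obtained from `s` by a finite sequence of mutations. -/
def MutationEquiv : QuantumSeed F r n → QuantumSeed F r n → Prop :=
  Relation.ReflTransGen fun s s' => ∃ k, s' = s.mutate K k

/-- The quantum torus `T_qM ⊆ F` of the toric frame `M` of `s`: the `R`-subalgebra generated by the
`M(eᵢ)^{±1}`. -/
def torus (s : QuantumSeed F r n) : Subalgebra (QRing K) F :=
  Algebra.adjoin (QRing K) (Set.range s.x ∪ Set.range fun i => (s.x i)⁻¹)

/-- The element `M(eᵢ)` of `T_qM`. -/
def torusVar (s : QuantumSeed F r n) (i : Fin (r + n)) : s.torus K :=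
  ⟨s.x i, Algebra.subset_adjoin (Or.inl ⟨i, rfl⟩)⟩

/-- The upper quantum cluster algebra `T_qM ∩ T_qM₁ ∩ ⋯ ∩ T_qM_r`, where `M_k` is the toric frame of
the mutated quantum seed `μ_k(M, B̃)`. -/
def upper (s : QuantumSeed F r n) : Subalgebra (QRing K) F :=
  s.torus K ⊓ ⨅ k, (s.mutate K k).torus K

/-- The inclusion `j : U_q → T_qM`. -/
def upperIncl (s : QuantumSeed F r n) : s.upper K →ₐ[QRing K] s.torus K :=
  Subalgebra.inclusion inf_le_left

end QuantumSeed

/-- The initial quantum seed `(M, B̃)` with `M(eᵢ) = Xᵢ`. -/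
def initialQuantumSeed (K : Type*) [Field K] {r n : ℕ} (Λ : Matrix (Fin (r + n)) (Fin (r + n)) ℤ)
    (B : Matrix (Fin (r + n)) (Fin r) ℤ) : QuantumSeed (QuantumField K Λ) r n where
  Λ := Λ
  B := B
  x := fun i => OreLocalization.numeratorHom (QuantumTorus.X K Λ (Pi.single i 1))

/-! ### The commutative cluster algebra and upper cluster algebra -/

/-- The Laurent polynomial ring `K[X₁^{±1}, …, X_m^{±1}]`. -/
abbrev Laurent (K : Type*) [Field K] (m : ℕ) : Type _ := AddMonoidAlgebra K (Fin m → ℤ)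

/-- The variable `Xᵢ`. -/
def Laurent.X (K : Type*) [Field K] {m : ℕ} (i : Fin m) : Laurent K m :=
  AddMonoidAlgebra.single (Pi.single i 1) 1

/-- The field `K(X₁, …, X_m)`. -/
abbrev RatField (K : Type*) [Field K] (m : ℕ) : Type _ := FractionRing (Laurent K m)

/-- The data of a seed in a field `F`. -/
structure Seed (F : Type*) (r n : ℕ) where
  /-- the extended exchange matrix -/
  B : Matrix (Fin (r + n)) (Fin r) ℤ
  /-- the cluster -/
  x : Fin (r + n) → F

namespace Seed

variable {F : Type*} [Field F] {r n : ℕ}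

/-- The seed mutation `μ_k`. -/
def mutate (s : Seed F r n) (k : Fin r) : Seed F r n where
  B := mutateMatrix s.B k
  x := Function.update s.x (Fin.castAdd n k)
    ((∏ i, s.x i ^ max (s.B i k) 0 + ∏ i, s.x i ^ max (-s.B i k) 0) / s.x (Fin.castAdd n k))

/-- `s'` is obtained from `s` by a finite sequence of mutations. -/
def MutationEquiv : Seed F r n → Seed F r n → Prop :=
  Relation.ReflTransGen fun s s' => ∃ k, s' = s.mutate k

variable (K : Type*) [Field K] [Algebra K F]

/-- The Laurent polynomial ring in the cluster of `s`, as a subalgebra of `F`. -/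
def torus (s : Seed F r n) : Subalgebra K F :=
  Algebra.adjoin K (Set.range s.x ∪ Set.range fun i => (s.x i)⁻¹)

/-- The cluster algebra: the `K`-subalgebra of `F` generated by all cluster variables and frozen
variables, and by the inverses of the frozen variables. -/
def clusterAlgebra (s : Seed F r n) : Subalgebra K F :=
  Algebra.adjoin K
    ({y | ∃ s', MutationEquiv s s' ∧ ∃ i, y = s'.x i} ∪
      Set.range fun j : Fin n => (s.x (Fin.natAdd r j))⁻¹)

/-- The upper cluster algebra: the intersection of the Laurent polynomial rings of all seeds that
are mutation equivalent to `s`. -/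
def upper (s : Seed F r n) : Subalgebra K F :=
  ⨅ (s' : Seed F r n) (_ : MutationEquiv s s'), s'.torus K

end Seed

/-- The initial seed of `B̃`. -/
def initialSeed (K : Type*) [Field K] {r n : ℕ} (B : Matrix (Fin (r + n)) (Fin r) ℤ) :
    Seed (RatField K (r + n)) r n where
  B := B
  x := fun i => algebraMap (Laurent K (r + n)) _ (Laurent.X K i)

/-- The cluster algebra `A(B̃)`. -/
def clusterA (K : Type*) [Field K] {r n : ℕ} (B : Matrix (Fin (r + n)) (Fin r) ℤ) :
    Subalgebra K (RatField K (r + n)) :=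
  (initialSeed K B).clusterAlgebra K

/-- The upper cluster algebra `U(B̃)`. -/
def clusterU (K : Type*) [Field K] {r n : ℕ} (B : Matrix (Fin (r + n)) (Fin r) ℤ) :
    Subalgebra K (RatField K (r + n)) :=
  (initialSeed K B).upper K

end QCA

end

noncomputable section

namespace QCA

open QuantumTorus

/-! ### Homomorphisms out of the quantum torus -/

namespace QuantumTorus

variable {K : Type*} [Field K] {m : ℕ} {Λ : Matrix (Fin m) (Fin m) ℤ}

/-! Write T(s) for the quantum torus of a seed s, and p = q^{1/2} - 1. The proof rests on two facts:
the upper algebra is invariant under mutation, and regularity at q = 1 can be followed through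
mutations.

Invariance reduces to the inclusion T(s) ∩ T(μ_i μ_k s) ⊆ T(μ_i s) for k ≠ i
(`torus_inf_torus_mutate_mutate_le`). Let E be the preimage of T(μ_i s) in the based torus of s, and
let v and w represent the k-th and i-th variables of μ_i μ_k s. An f representing an element of the
intersection is carried into E by left multiplication with powers of v and w, so E has to be
saturated under left division by v and w. Compatibility makes the columns i and k linearly
independent, so some grading φ vanishes on column i but not on column k
(`exists_separating_grading`). Then E is graded, because the exchange element in direction i is
homogeneous. The lowest component of v is a monomial, that of w is a scaled monomial times the
exchange element in direction i, and all these factors become invertible in T(μ_i s). Saturation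
under lowest components implies saturation (`mem_of_mul_mem`).

For the limit q = 1, the elements of the based torus with nonzero specialization form an Ore set.
The resulting local ring embeds in the skew field and maps to K(X_1, …, X_m), so elements regular at
q = 1 have well-defined values (`SpecializesTo`). `IsLimitSeed` couples a quantum seed to its
classical limit and is preserved by mutation. Since classical clusters are algebraically
independent, the frame monomials are independent over R (`IsLimitSeed.toricHom_injective`), and if x
is regular at q = 1 and p x lies in T(s), then x lies in T(s) (`IsLimitSeed.mem_torus_of_smul_mem`).

Consequently U_q ∩ p T(M) = p U_q, which is (i). For (ii), cluster variables and inverses of frozen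
variables lie in U_q and specialize to their classical counterparts, while U_q lies in every T(s')
and therefore specializes into every classical Laurent ring. -/

theorem smul_mono (a b : QRing K) (e : Fin m → ℤ) : a • mono Λ e b = mono Λ e (a * b) :=
  Finsupp.smul_single _ _ _

/-- A ring homomorphism from the quantum torus is given by central images of the scalars and images
of the basis elements that multiply correctly. -/
def lift {A : Type*} [Ring A] (ρ : QRing K →+* A) (hρ : ∀ a x, ρ a * x = x * ρ a)
    (M : (Fin m → ℤ) → A) (h1 : M 0 = 1)
    (hM : ∀ c d, M c * M d = ρ (qHalf K (form Λ c d)) * M (c + d)) : QuantumTorus K Λ →+* A :=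
  let L : QuantumTorus K Λ →+ A :=
    Finsupp.liftAddHom fun e => (AddMonoidHom.mulRight (M e)).comp ρ.toAddMonoidHom
  have hL : ∀ e a, L (mono Λ e a) = ρ a * M e := fun e a => Finsupp.liftAddHom_apply_single _ _ _
  { L with
    map_one' := by
      change L (mono Λ 0 1) = 1
      rw [hL, h1, map_one, one_mul]
    map_mul' := fun x y => by
      change L (x * y) = L x * L y
      induction x using induct with
      | h0 => simp only [zero_mul, map_zero]
      | ha x x' hx hx' => simp only [add_mul, map_add, hx, hx']
      | h1 e a =>
        induction y using induct with
        | h0 => simp only [mul_zero, map_zero]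
        | ha y y' hy hy' => simp only [mul_add, map_add, hy, hy']
        | h1 f b =>
          rw [mono_mul_mono, hL, hL, hL, map_mul, map_mul, mul_assoc (ρ a * ρ b), ← hM,
            mul_assoc, mul_assoc, ← mul_assoc (ρ b), hρ b, mul_assoc] }

theorem lift_mono {A : Type*} [Ring A] (ρ : QRing K →+* A) (hρ : ∀ a x, ρ a * x = x * ρ a)
    (M : (Fin m → ℤ) → A) (h1 : M 0 = 1)
    (hM : ∀ c d, M c * M d = ρ (qHalf K (form Λ c d)) * M (c + d)) (e : Fin m → ℤ) (a : QRing K) :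
    lift ρ hρ M h1 hM (mono Λ e a) = ρ a * M e :=
  Finsupp.liftAddHom_apply_single _ _ _

end QuantumTorus

/-! ### Toric frames -/

section QComm

variable {K : Type*} [Field K] {F : Type*} [DivisionRing F] [Algebra (QRing K) F]

theorem qHalf_smul_smul (a b : ℤ) (x : F) : qHalf K a • qHalf K b • x = qHalf K (a + b) • x := by
  rw [smul_smul, qHalf_add]

theorem eq_qHalf_smul_iff {a : ℤ} {x y : F} : x = qHalf K a • y ↔ qHalf K (-a) • x = y := by
  constructor
  · rintro rfl
    rw [qHalf_smul_smul, neg_add_cancel, qHalf_zero, one_smul]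
  · rintro rfl
    rw [qHalf_smul_smul, add_neg_cancel, qHalf_zero, one_smul]

variable (K) in
/-- `x y = q^{a/2} y x`. -/
def QComm (a : ℤ) (x y : F) : Prop := x * y = qHalf K a • (y * x)

theorem QComm.symm {a : ℤ} {x y : F} (h : QComm K a x y) : QComm K (-a) y x :=
  (eq_qHalf_smul_iff.1 h).symm

theorem QComm.one_left (y : F) : QComm K 0 1 y := by
  simp [QComm, qHalf_zero]

theorem QComm.mul_left {a b : ℤ} {x y z : F} (h : QComm K a x z) (h' : QComm K b y z) :
    QComm K (a + b) (x * y) z := by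
  unfold QComm at *
  rw [mul_assoc, h', mul_smul_comm, ← mul_assoc, h, smul_mul_assoc, qHalf_smul_smul, mul_assoc,
    add_comm]

theorem QComm.inv_left {a : ℤ} {x y : F} (h : QComm K a x y) (hx : x ≠ 0) :
    QComm K (-a) x⁻¹ y := by
  unfold QComm at *
  have h2 := congrArg (fun z => x⁻¹ * z * x⁻¹) h
  simp only [mul_smul_comm, smul_mul_assoc] at h2
  rw [← mul_assoc, inv_mul_cancel₀ hx, one_mul, mul_assoc, mul_assoc, mul_inv_cancel₀ hx, mul_one] at h2
  rw [h2, qHalf_smul_smul, neg_add_cancel, qHalf_zero, one_smul]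

theorem QComm.pow_left {a : ℤ} {x y : F} (h : QComm K a x y) (n : ℕ) :
    QComm K (n * a) (x ^ n) y := by
  induction n with
  | zero => simpa using QComm.one_left y
  | succ n ih =>
    have := ih.mul_left h
    rw [pow_succ]
    convert this using 1
    push_cast
    ring

theorem QComm.zpow_left {a : ℤ} {x y : F} (h : QComm K a x y) (hx : x ≠ 0) (n : ℤ) :
    QComm K (n * a) (x ^ n) y := by
  obtain ⟨n, rfl | rfl⟩ := n.eq_nat_or_neg
  · simpa using h.pow_left n
  · have := (h.pow_left n).inv_left (pow_ne_zero n hx)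
    rw [zpow_neg, zpow_natCast]
    convert this using 1
    ring

theorem QComm.zpow_right {a : ℤ} {x y : F} (h : QComm K a x y) (hy : y ≠ 0) (n : ℤ) :
    QComm K (n * a) x (y ^ n) := by
  have := (h.symm.zpow_left hy n).symm
  convert this using 1
  ring

theorem QComm.add_right {a : ℤ} {x y z : F} (h : QComm K a x y) (h' : QComm K a x z) :
    QComm K a x (y + z) := by
  unfold QComm at *
  rw [mul_add, h, h', add_mul, smul_add]

/-- The ordered monomial `x₁^{c₁} ⋯ x_m^{c_m}`. -/
def ordMon {m : ℕ} (x : Fin m → F) (c : Fin m → ℤ) : F := (List.ofFn fun i => x i ^ c i).prod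

theorem ordMon_succ {m : ℕ} (x : Fin (m + 1) → F) (c : Fin (m + 1) → ℤ) :
    ordMon x c = x 0 ^ c 0 * ordMon (fun i => x i.succ) (fun i => c i.succ) := by
  simp [ordMon, List.ofFn_succ]

theorem ordMon_qComm {m : ℕ} {x : Fin m → F} {y : F} {a : Fin m → ℤ} (hx : ∀ i, x i ≠ 0)
    (h : ∀ i, QComm K (a i) (x i) y) (c : Fin m → ℤ) :
    QComm K (∑ i, c i * a i) (ordMon x c) y := by
  induction m with
  | zero => simpa [ordMon] using QComm.one_left y
  | succ m ih =>
    rw [ordMon_succ, Fin.sum_univ_succ]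
    exact ((h 0).zpow_left (hx 0) _).mul_left (ih (fun i => hx _) (fun i => h _) _)

/-- Each power of x_j coming from `d` is moved to the left past the powers of x_i coming from `c`
with j < i. Such a pair contributes c_i d_j L_ij to the exponent. -/
theorem ordMon_mul {m : ℕ} {x : Fin m → F} {L : Fin m → Fin m → ℤ} (hx : ∀ i, x i ≠ 0)
    (h : ∀ i j, QComm K (L i j) (x i) (x j)) (c d : Fin m → ℤ) :
    ordMon x c * ordMon x d =
      qHalf K (∑ i, ∑ j, if j < i then c i * d j * L i j else 0) • ordMon x (c + d) := by
  induction m with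
  | zero => simp [ordMon, qHalf_zero]
  | succ m ih =>
    have h1 := (ordMon_qComm (K := K) (x := fun i : Fin m => x i.succ) (fun i => hx _)
      (fun i => h i.succ 0) (fun i => c i.succ)).zpow_right (hx 0) (d 0)
    have h2 := ih (x := fun i => x i.succ) (fun i => hx _) (fun i j => h i.succ j.succ)
      (fun i => c i.succ) (fun i => d i.succ)
    unfold QComm at h1
    have h3 : ordMon x c * ordMon x d = x 0 ^ c 0 * ((ordMon (fun i => x i.succ) fun i => c i.succ) *
        x 0 ^ d 0) * (ordMon (fun i => x i.succ) fun i => d i.succ) := by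
      rw [ordMon_succ, ordMon_succ]
      simp only [mul_assoc]
    rw [h3, h1, mul_smul_comm, smul_mul_assoc, ← mul_assoc, ← zpow_add₀ (hx 0), mul_assoc, h2,
      mul_smul_comm, qHalf_smul_smul, ordMon_succ]
    congr 2
    rw [Fin.sum_univ_succ]
    simp only [Fin.sum_univ_succ, not_lt_zero, if_false, Finset.sum_const_zero, Fin.succ_pos,
      if_true, Fin.succ_lt_succ_iff, Finset.sum_add_distrib, Finset.mul_sum, zero_add]
    congr 1
    exact Finset.sum_congr rfl fun i _ => by ring

theorem ordMon_zero {m : ℕ} (x : Fin m → F) : ordMon x 0 = 1 := by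
  induction m with
  | zero => simp [ordMon]
  | succ m ih =>
    rw [ordMon_succ]
    rw [Pi.zero_apply, zpow_zero, one_mul]
    exact ih fun i => x i.succ

theorem ordMon_single {m : ℕ} (x : Fin m → F) (i : Fin m) (a : ℤ) :
    ordMon x (Pi.single i a) = x i ^ a := by
  induction m with
  | zero => exact i.elim0
  | succ m ih =>
    rw [ordMon_succ]
    refine Fin.cases ?_ (fun i => ?_) i
    · rw [Pi.single_eq_same]
      convert mul_one _
      convert ordMon_zero _ with j
      simp
    · rw [Pi.single_eq_of_ne (Fin.succ_ne_zero i).symm, zpow_zero, one_mul]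
      convert ih (fun i => x i.succ) i using 2
      ext j
      simp [Pi.single_apply]

end QComm

/-! ### Bilinearity and skew-symmetry of the form Λ -/

section Form

variable {m : ℕ} {Λ : Matrix (Fin m) (Fin m) ℤ}

theorem form_eq_sum (c d : Fin m → ℤ) : form Λ c d = ∑ i, ∑ j, c i * d j * Λ i j := by
  simp only [form, dotProduct, Matrix.mulVec, Finset.mul_sum]
  exact Finset.sum_congr rfl fun i _ => Finset.sum_congr rfl fun j _ => by ring

theorem form_skew (h : ∀ i j, Λ i j = -Λ j i) (c d : Fin m → ℤ) : form Λ c d = -form Λ d c := by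
  rw [form_eq_sum, form_eq_sum, Finset.sum_comm, ← Finset.sum_neg_distrib]
  refine Finset.sum_congr rfl fun i _ => ?_
  rw [← Finset.sum_neg_distrib]
  refine Finset.sum_congr rfl fun j _ => ?_
  rw [h j i]
  ring

theorem form_self (h : ∀ i j, Λ i j = -Λ j i) (c : Fin m → ℤ) : form Λ c c = 0 := by
  have := form_skew h c c
  omega

theorem form_neg_left (c d : Fin m → ℤ) : form Λ (-c) d = -form Λ c d := by
  simp [form]

theorem form_neg_right (c d : Fin m → ℤ) : form Λ c (-d) = -form Λ c d := by
  simp [form, Matrix.mulVec_neg]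

theorem form_sub_left (c d e : Fin m → ℤ) : form Λ (c - d) e = form Λ c e - form Λ d e := by
  rw [sub_eq_add_neg, form_add_left, form_neg_left, sub_eq_add_neg]

theorem form_sub_right (c d e : Fin m → ℤ) : form Λ c (d - e) = form Λ c d - form Λ c e := by
  rw [sub_eq_add_neg, form_add_right, form_neg_right, sub_eq_add_neg]

theorem form_smul_left (a : ℤ) (c d : Fin m → ℤ) : form Λ (a • c) d = a * form Λ c d := by
  rw [form, smul_dotProduct, smul_eq_mul, form]

theorem form_smul_right (a : ℤ) (c d : Fin m → ℤ) : form Λ c (a • d) = a * form Λ c d := by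
  rw [form, Matrix.mulVec_smul, dotProduct_smul, smul_eq_mul, form]

theorem form_single (i j : Fin m) : form Λ (Pi.single i 1) (Pi.single j 1) = Λ i j := by
  simp [form]

end Form

/-! ### Toric quantum seeds and their frames -/

namespace QuantumSeed

variable {K : Type*} [Field K] {F : Type*} [DivisionRing F] [Algebra (QRing K) F] {r n : ℕ}

variable (K) in
/-- The cluster variables of `s` are nonzero and `q`-commute according to the skew-symmetric
matrix `Λ`. -/
structure IsToric (s : QuantumSeed F r n) : Prop where
  skew : ∀ i j, s.Λ i j = -s.Λ j i
  ne_zero : ∀ i, s.x i ≠ 0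
  comm : ∀ i j, QComm K (2 * s.Λ i j) (s.x i) (s.x j)

variable {s : QuantumSeed F r n}

theorem frame_eq (c : Fin (r + n) → ℤ) : s.frame K c =
    qHalf K (-∑ i, ∑ j, if i < j then c i * c j * s.Λ i j else 0) • ordMon s.x c := by
  rw [frame, ordMon]
  congr 3
  refine Finset.sum_congr rfl fun i _ => ?_
  rw [← Finset.sum_filter]
  refine Finset.sum_congr ?_ fun _ _ => rfl
  ext j
  simp

theorem frame_zero : s.frame K 0 = 1 := by
  rw [frame_eq, ordMon_zero]
  simp [qHalf_zero]

theorem frame_single_zpow (i : Fin (r + n)) (a : ℤ) :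
    s.frame K (Pi.single i a) = s.x i ^ a := by
  rw [frame_eq, ordMon_single, Finset.sum_eq_zero, neg_zero, qHalf_zero, one_smul]
  intro a _
  refine Finset.sum_eq_zero fun b _ => ?_
  split_ifs with h
  · by_cases ha : a = i
    · subst ha
      simp [Pi.single_eq_of_ne h.ne']
    · simp [Pi.single_eq_of_ne ha]
  · rfl

theorem frame_single (i : Fin (r + n)) : s.frame K (Pi.single i 1) = s.x i := by
  rw [frame_single_zpow, zpow_one]

namespace IsToric

theorem frame_mul (hs : s.IsToric K) (c d : Fin (r + n) → ℤ) :
    s.frame K c * s.frame K d = qHalf K (form s.Λ c d) • s.frame K (c + d) := by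
  rw [frame_eq, frame_eq, frame_eq, smul_mul_assoc, mul_smul_comm,
    ordMon_mul hs.ne_zero hs.comm, qHalf_smul_smul, qHalf_smul_smul, qHalf_smul_smul]
  congr 2
  have h1 : ∑ i, ∑ j, (if j < i then c i * d j * s.Λ i j else 0)
      = - ∑ i, ∑ j, (if i < j then c j * d i * s.Λ i j else 0) := by
    rw [Finset.sum_comm, ← Finset.sum_neg_distrib]
    refine Finset.sum_congr rfl fun i _ => ?_
    rw [← Finset.sum_neg_distrib]
    refine Finset.sum_congr rfl fun j _ => ?_
    rw [hs.skew j i]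
    split_ifs <;> ring
  -- Half of the reordering exponent is transferred to the pairs i < j by skew-symmetry. After that
  -- the exponent agrees with the normalizing factors pair by pair.
  have h2 : ∑ i, ∑ j, (if j < i then c i * d j * (2 * s.Λ i j) else 0)
      = ∑ i, ∑ j, (if j < i then c i * d j * s.Λ i j else 0) +
        - ∑ i, ∑ j, (if i < j then c j * d i * s.Λ i j else 0) := by
    rw [← h1]
    simp only [← Finset.sum_add_distrib]
    refine Finset.sum_congr rfl fun i _ => Finset.sum_congr rfl fun j _ => ?_
    split_ifs <;> ring
  rw [h2, form_eq_sum]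
  simp only [← Finset.sum_add_distrib, ← Finset.sum_neg_distrib]
  refine Finset.sum_congr rfl fun i _ => Finset.sum_congr rfl fun j _ => ?_
  simp only [Pi.add_apply]
  rcases lt_trichotomy i j with h | h | h
  · simp only [h, h.not_gt, if_true, if_false]
    ring
  · subst h
    have := hs.skew i i
    have h0 : s.Λ i i = 0 := by omega
    simp [h0]
  · simp only [h, h.not_gt, if_true, if_false]
    ring

theorem frame_inv (hs : s.IsToric K) (c : Fin (r + n) → ℤ) : (s.frame K c)⁻¹ = s.frame K (-c) := by
  refine inv_eq_of_mul_eq_one_right ?_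
  rw [hs.frame_mul, form_neg_right, form_self hs.skew, neg_zero, qHalf_zero, one_smul,
    add_neg_cancel, frame_zero]

theorem frame_add (hs : s.IsToric K) (c d : Fin (r + n) → ℤ) :
    s.frame K (c + d) = qHalf K (-form s.Λ c d) • (s.frame K c * s.frame K d) := by
  rw [hs.frame_mul, qHalf_smul_smul, neg_add_cancel, qHalf_zero, one_smul]

theorem frame_qComm (hs : s.IsToric K) (c d : Fin (r + n) → ℤ) :
    QComm K (2 * form s.Λ c d) (s.frame K c) (s.frame K d) := by
  unfold QComm
  rw [hs.frame_mul, hs.frame_mul, qHalf_smul_smul, form_skew hs.skew d c, add_comm d c]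
  congr 2
  ring

/-- The homomorphism `X^c ↦ M(c)` from the based quantum torus to `F`. -/
def toricHom (hs : s.IsToric K) : QuantumTorus K s.Λ →ₐ[QRing K] F :=
  AlgHom.mk' (QuantumTorus.lift (algebraMap (QRing K) F) Algebra.commutes (s.frame K) frame_zero
    fun c d => by rw [hs.frame_mul, Algebra.smul_def]) fun a f => by
      induction f using induct with
      | h0 => simp only [smul_zero, map_zero]
      | ha x y hx hy => simp only [smul_add, map_add, hx, hy]
      | h1 e b => rw [smul_mono, lift_mono, lift_mono, map_mul, Algebra.smul_def, mul_assoc]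

theorem toricHom_mono (hs : s.IsToric K) (c : Fin (r + n) → ℤ) (a : QRing K) :
    hs.toricHom (mono s.Λ c a) = a • s.frame K c := by
  rw [Algebra.smul_def]
  exact QuantumTorus.lift_mono (algebraMap (QRing K) F) Algebra.commutes (s.frame K) frame_zero
    (fun c d => by rw [hs.frame_mul, Algebra.smul_def]) c a

theorem toricHom_X (hs : s.IsToric K) (c : Fin (r + n) → ℤ) :
    hs.toricHom (QuantumTorus.X K s.Λ c) = s.frame K c := by
  rw [QuantumTorus.X, toricHom_mono, one_smul]

end IsToric

theorem x_mem_torus (i : Fin (r + n)) : s.x i ∈ s.torus K := Algebra.subset_adjoin (Or.inl ⟨i, rfl⟩)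

theorem x_inv_mem_torus (i : Fin (r + n)) : (s.x i)⁻¹ ∈ s.torus K :=
  Algebra.subset_adjoin (Or.inr ⟨i, rfl⟩)

theorem x_zpow_mem_torus (i : Fin (r + n)) (a : ℤ) : s.x i ^ a ∈ s.torus K := by
  obtain ⟨a, rfl | rfl⟩ := a.eq_nat_or_neg
  · rw [zpow_natCast]
    exact pow_mem (x_mem_torus i) a
  · rw [zpow_neg, zpow_natCast, ← inv_pow]
    exact pow_mem (x_inv_mem_torus i) a

theorem frame_mem {A : Subalgebra (QRing K) F} {c : Fin (r + n) → ℤ}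
    (h : ∀ i, s.x i ^ c i ∈ A) : s.frame K c ∈ A := by
  refine A.smul_mem (A.list_prod_mem fun y hy => ?_) _
  obtain ⟨i, rfl⟩ := (List.mem_ofFn' _ _).1 hy
  exact h i

theorem frame_mem_torus (c : Fin (r + n) → ℤ) : s.frame K c ∈ s.torus K :=
  frame_mem fun i => x_zpow_mem_torus i (c i)

namespace IsToric

theorem toricHom_mem_torus (hs : s.IsToric K) (f : QuantumTorus K s.Λ) :
    hs.toricHom f ∈ s.torus K := by
  induction f using induct with
  | h0 => simp
  | ha x y hx hy => rw [map_add]; exact add_mem hx hy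
  | h1 e a => rw [toricHom_mono]; exact Subalgebra.smul_mem _ (frame_mem_torus e) a

theorem range_toricHom (hs : s.IsToric K) : hs.toricHom.range = s.torus K := by
  apply le_antisymm
  · rintro _ ⟨f, rfl⟩
    exact hs.toricHom_mem_torus f
  · refine Algebra.adjoin_le ?_
    rintro _ (⟨i, rfl⟩ | ⟨i, rfl⟩)
    · exact ⟨_, (hs.toricHom_X _).trans (frame_single i)⟩
    · refine ⟨_, (hs.toricHom_X (-Pi.single i 1)).trans ?_⟩
      rw [← hs.frame_inv, frame_single]

theorem mem_torus_iff (hs : s.IsToric K) {z : F} :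
    z ∈ s.torus K ↔ ∃ f, hs.toricHom f = z := by
  rw [← hs.range_toricHom]
  rfl

end IsToric

end QuantumSeed

/-! ### Gradings of the quantum torus -/

namespace QuantumTorus

variable {K : Type*} [Field K] {m : ℕ} {Λ : Matrix (Fin m) (Fin m) ℤ}

/-- The coefficient of `X^e`. -/
def coeff (x : QuantumTorus K Λ) (e : Fin m → ℤ) : QRing K := (show (Fin m → ℤ) →₀ QRing K from x) e

theorem coeff_mono (e f : Fin m → ℤ) (a : QRing K) [Decidable (e = f)] :
    (mono Λ e a).coeff f = if e = f then a else 0 :=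
  Finsupp.single_apply

theorem coeff_zero (e : Fin m → ℤ) : (0 : QuantumTorus K Λ).coeff e = 0 := rfl

theorem coeff_add (x y : QuantumTorus K Λ) (e : Fin m → ℤ) :
    (x + y).coeff e = x.coeff e + y.coeff e := rfl

theorem coeff_sub (x y : QuantumTorus K Λ) (e : Fin m → ℤ) :
    (x - y).coeff e = x.coeff e - y.coeff e := rfl

theorem coeff_smul (a : QRing K) (x : QuantumTorus K Λ) (e : Fin m → ℤ) :
    (a • x).coeff e = a * x.coeff e := rfl

theorem coeff_ext {x y : QuantumTorus K Λ} (h : ∀ e, x.coeff e = y.coeff e) : x = y :=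
  Finsupp.ext h

theorem finite_coeff (x : QuantumTorus K Λ) : {e | x.coeff e ≠ 0}.Finite :=
  (show (Fin m → ℤ) →₀ QRing K from x).hasFiniteSupport

/-- All exponents occurring in `x` satisfy `P`. -/
def SuppIn (P : (Fin m → ℤ) → Prop) (x : QuantumTorus K Λ) : Prop := ∀ e, x.coeff e ≠ 0 → P e

namespace SuppIn

variable {P Q S : (Fin m → ℤ) → Prop} {x y : QuantumTorus K Λ}

theorem zero : SuppIn P (0 : QuantumTorus K Λ) := fun e h => absurd (coeff_zero e) h

theorem mono {e : Fin m → ℤ} (h : P e) (a : QRing K) : SuppIn P (mono Λ e a) := by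
  classical
  intro f hf
  rw [coeff_mono] at hf
  split_ifs at hf with h'
  · exact h' ▸ h
  · exact absurd rfl hf

theorem add (hx : SuppIn P x) (hy : SuppIn P y) : SuppIn P (x + y) := by
  intro e h
  by_cases h1 : x.coeff e = 0
  · refine hy e fun h2 => h ?_
    rw [coeff_add, h1, h2, add_zero]
  · exact hx e h1

theorem smul (hx : SuppIn P x) (a : QRing K) : SuppIn P (a • x) := by
  intro e h
  refine hx e fun h2 => h ?_
  rw [coeff_smul, h2, mul_zero]

theorem imp (hx : SuppIn P x) (h : ∀ e, P e → Q e) : SuppIn Q x := fun e he => h e (hx e he)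

theorem mul (hx : SuppIn P x) (hy : SuppIn Q y) (h : ∀ e f, P e → Q f → S (e + f)) :
    SuppIn S (x * y) := by
  intro g hg
  have hm := mulL_apply (Λ := Λ) (show (Fin m → ℤ) →₀ QRing K from x) y g
  rw [show (x * y).coeff g = _ from hm] at hg
  obtain ⟨e, he, h1⟩ := Finset.exists_ne_zero_of_sum_ne_zero hg
  obtain ⟨f, hf, h2⟩ := Finset.exists_ne_zero_of_sum_ne_zero h1
  have h3 : e + f = g := by
    by_contra h
    exact h2 (if_neg h)
  rw [← h3]
  exact h e f (hx e (Finsupp.mem_support_iff.1 he)) (hy f (Finsupp.mem_support_iff.1 hf))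

end SuppIn

theorem induct_suppIn {P : (Fin m → ℤ) → Prop} {C : QuantumTorus K Λ → Prop}
    {x : QuantumTorus K Λ} (hx : SuppIn P x) (h0 : C 0) (ha : ∀ x y, C x → C y → C (x + y))
    (h1 : ∀ e a, P e → C (mono Λ e a)) : C x := by
  have h : x = ∑ e ∈ (show (Fin m → ℤ) →₀ QRing K from x).support, mono Λ e (x.coeff e) :=
    (Finsupp.sum_single (show (Fin m → ℤ) →₀ QRing K from x)).symm
  rw [h]
  refine Finset.sum_induction _ _ ha h0 fun e he => h1 e _ (hx e (Finsupp.mem_support_iff.1 he))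

variable (φ : (Fin m → ℤ) →+ ℤ)

open Classical in
/-- The component of degree `d` of `x` with respect to the grading `φ`. -/
def comp (d : ℤ) (x : QuantumTorus K Λ) : QuantumTorus K Λ :=
  Finsupp.filter (fun e => φ e = d) (show (Fin m → ℤ) →₀ QRing K from x)

theorem coeff_comp (d : ℤ) (x : QuantumTorus K Λ) (e : Fin m → ℤ) :
    (comp φ d x).coeff e = if φ e = d then x.coeff e else 0 := by
  classical
  refine (Finsupp.filter_apply (fun e => φ e = d) (show (Fin m → ℤ) →₀ QRing K from x) e).trans ?_
  split_ifs <;> rfl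

variable {φ}

theorem comp_add (d : ℤ) (x y : QuantumTorus K Λ) :
    comp φ d (x + y) = comp φ d x + comp φ d y := by
  refine coeff_ext fun e => ?_
  simp only [coeff_comp, coeff_add]
  split_ifs <;> simp

theorem suppIn_comp (d : ℤ) (x : QuantumTorus K Λ) : SuppIn (fun e => φ e = d) (comp φ d x) := by
  intro e h
  by_contra h'
  rw [coeff_comp, if_neg h'] at h
  exact h rfl

theorem comp_of_suppIn {d : ℤ} {x : QuantumTorus K Λ} (h : SuppIn (fun e => φ e = d) x) :
    comp φ d x = x := by
  refine coeff_ext fun e => ?_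
  rw [coeff_comp]
  split_ifs with h1
  · rfl
  · by_contra h2
    exact h1 (h e (Ne.symm h2))

theorem comp_of_suppIn_ne {d : ℤ} {x : QuantumTorus K Λ} (h : SuppIn (fun e => φ e ≠ d) x) :
    comp φ d x = 0 := by
  refine coeff_ext fun e => ?_
  rw [coeff_comp, coeff_zero]
  split_ifs with h1
  · by_contra h2
    exact h e h2 h1
  · rfl

theorem suppIn_sub_comp (d : ℤ) (x : QuantumTorus K Λ) :
    SuppIn (fun e => φ e ≠ d) (x - comp φ d x) := by
  intro e h h'
  rw [coeff_sub, coeff_comp, if_pos h', sub_self] at h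
  exact h rfl

theorem comp_mul {d n : ℤ} {g f : QuantumTorus K Λ} (hg : SuppIn (fun e => φ e = d) g) :
    comp φ (d + n) (g * f) = g * comp φ n f := by
  have h : g * f = g * comp φ n f + g * (f - comp φ n f) := by rw [← mul_add, add_sub_cancel]
  rw [h, comp_add, comp_of_suppIn (hg.mul (suppIn_comp n f) fun e f he hf => ?_),
    comp_of_suppIn_ne (hg.mul (suppIn_sub_comp n f) fun e f he hf => ?_), add_zero]
  · rw [map_add, he]
    exact fun h => hf (add_left_cancel h)
  · rw [map_add, he, hf]

variable (φ) in
/-- `x₀` is the lowest component of `x` with respect to `φ`, and it has degree `d`. -/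
structure HasLow (d : ℤ) (x x₀ : QuantumTorus K Λ) : Prop where
  homog : SuppIn (fun e => φ e = d) x₀
  higher : SuppIn (fun e => d < φ e) (x - x₀)

namespace HasLow

variable {d d' : ℤ} {x x₀ y y₀ : QuantumTorus K Λ}

theorem self (h : SuppIn (fun e => φ e = d) x) : HasLow φ d x x :=
  ⟨h, by rw [sub_self]; exact SuppIn.zero⟩

theorem mono (e : Fin m → ℤ) (a : QRing K) :
    HasLow φ (φ e) (QuantumTorus.mono Λ e a) (QuantumTorus.mono Λ e a) :=
  self (SuppIn.mono (P := fun f => φ f = φ e) rfl a)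

theorem add (hx : HasLow φ d x x₀) (hy : HasLow φ d y y₀) : HasLow φ d (x + y) (x₀ + y₀) :=
  ⟨hx.homog.add hy.homog, by rw [add_sub_add_comm]; exact hx.higher.add hy.higher⟩

theorem add_higher (hx : HasLow φ d x x₀) (hy : SuppIn (fun e => d < φ e) y) :
    HasLow φ d (x + y) x₀ :=
  ⟨hx.homog, by rw [add_sub_right_comm]; exact hx.higher.add hy⟩

theorem smul (hx : HasLow φ d x x₀) (a : QRing K) : HasLow φ d (a • x) (a • x₀) :=
  ⟨hx.homog.smul a, by rw [← smul_sub]; exact hx.higher.smul a⟩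

theorem mul (hx : HasLow φ d x x₀) (hy : HasLow φ d' y y₀) :
    HasLow φ (d + d') (x * y) (x₀ * y₀) := by
  refine ⟨hx.homog.mul hy.homog fun e f he hf => by rw [map_add, he, hf], ?_⟩
  have h : x * y - x₀ * y₀ = x₀ * (y - y₀) + (x - x₀) * y₀ + (x - x₀) * (y - y₀) := by
    noncomm_ring
  rw [h]
  refine ((hx.homog.mul hy.higher ?_).add (hx.higher.mul hy.homog ?_)).add
    (hx.higher.mul hy.higher ?_)
  all_goals
    intro e f he hf
    rw [map_add]
    omega

end HasLow

/-- If a graded subalgebra is saturated under left division by the lowest component of one of its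
elements `g`, then it is saturated under left division by `g`. -/
theorem mem_of_mul_mem {E : Subalgebra (QRing K) (QuantumTorus K Λ)}
    (hE : ∀ f ∈ E, ∀ n, comp φ n f ∈ E) {d : ℤ} {g g₀ : QuantumTorus K Λ} (hg : HasLow φ d g g₀)
    (hgE : g ∈ E) (h₀ : ∀ f, g₀ * f ∈ E → f ∈ E) (f : QuantumTorus K Λ) (hf : g * f ∈ E) :
    f ∈ E := by
  -- The induction is on the number of monomials of `f`: the lowest component is shown to lie in `E`
  -- and is then split off.
  induction hN : f.finite_coeff.toFinset.card using Nat.strong_induction_on generalizing f with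
  | _ N ih =>
  subst hN
  by_cases hne : f.finite_coeff.toFinset.Nonempty
  · obtain ⟨a, ha, hmin⟩ := Finset.exists_min_image _ φ hne
    have hlow : HasLow φ (φ a) f (comp φ (φ a) f) := by
      refine ⟨suppIn_comp _ _, fun e he => ?_⟩
      have h1 := suppIn_sub_comp _ _ e he
      rw [coeff_sub, coeff_comp, if_neg h1, sub_zero] at he
      exact lt_of_le_of_ne (hmin e (by simpa using he)) (Ne.symm h1)
    -- Lowest components multiply. The left side lies in `E` because `E` is graded, so the
    -- hypothesis on `g₀` puts the lowest component of `f` in `E`.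
    have h1 : comp φ (d + φ a) (g * f) = g₀ * comp φ (φ a) f := by
      have h2 := hg.mul hlow
      rw [← add_sub_cancel (g₀ * comp φ (φ a) f) (g * f), comp_add, comp_of_suppIn h2.homog,
        comp_of_suppIn_ne (h2.higher.imp fun e h => h.ne'), add_zero]
    have h3 : comp φ (φ a) f ∈ E := h₀ _ (h1 ▸ hE _ hf _)
    have h4 : f - comp φ (φ a) f ∈ E := by
      refine ih _ (Finset.card_lt_card ?_) (f - comp φ (φ a) f) ?_ rfl
      · refine ⟨fun e he => ?_, fun h => ?_⟩
        · simp only [Set.Finite.mem_toFinset, Set.mem_ofPred_eq] at he ⊢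
          have h1 := suppIn_sub_comp _ _ e he
          rwa [coeff_sub, coeff_comp, if_neg h1, sub_zero] at he
        · have := h ha
          simp only [Set.Finite.mem_toFinset, Set.mem_ofPred_eq] at this
          exact suppIn_sub_comp _ _ a this rfl
      · rw [mul_sub]
        exact sub_mem hf (mul_mem hgE h3)
    rw [← add_sub_cancel (comp φ (φ a) f) f]
    exact add_mem h3 h4
  · have : f = 0 := by
      refine coeff_ext fun e => ?_
      by_contra h
      exact hne ⟨e, by simpa [coeff_zero] using h⟩
    rw [this]
    exact zero_mem _

end QuantumTorus

/-! ### Compatible pairs under mutation -/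

section Reflect

variable {m : ℕ}

/-- The linear map fixing `e_j` for `j ≠ k` and sending `e_k` to `-e_k + ∑_{i ≠ k} [-bᵢ]₊ eᵢ`. -/
def reflect (b : Fin m → ℤ) (k : Fin m) : (Fin m → ℤ) →+ (Fin m → ℤ) where
  toFun c := fun a => if a = k then -c k else c a + c k * max (-b a) 0
  map_zero' := by
    ext a
    simp
  map_add' c d := by
    ext a
    simp only [Pi.add_apply]
    split_ifs <;> ring

theorem reflect_apply (b : Fin m → ℤ) (k : Fin m) (c : Fin m → ℤ) (a : Fin m) :
    reflect b k c a = if a = k then -c k else c a + c k * max (-b a) 0 := rfl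

theorem reflect_of_eq_zero (b : Fin m → ℤ) {k : Fin m} {c : Fin m → ℤ} (hc : c k = 0) :
    reflect b k c = c := by
  ext a
  rw [reflect_apply]
  split_ifs with h
  · rw [h, hc, neg_zero]
  · rw [hc, zero_mul, add_zero]

/-- Since [b]₊ - [-b]₊ = b, the two sign choices for the matrix E differ by a shift along `b`. -/
theorem reflect_neg (b : Fin m → ℤ) {k : Fin m} (hb : b k = 0) (c : Fin m → ℤ) :
    reflect (-b) k c = reflect b k c + c k • b := by
  ext a
  simp only [reflect_apply, Pi.add_apply, Pi.smul_apply, Pi.neg_apply, smul_eq_mul, neg_neg]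
  split_ifs with h
  · rw [h, hb]
    ring
  · rw [max_neg_zero]
    ring

/-- The second of two mutations in direction k uses the column `-b`. The composite is therefore a
transvection along `b` and not the identity. It still preserves the form of a compatible pair. -/
theorem reflect_reflect_neg (b : Fin m → ℤ) {k : Fin m} (hb : b k = 0) (c : Fin m → ℤ) :
    reflect b k (reflect (-b) k c) = c + c k • b := by
  ext a
  simp only [reflect_apply, Pi.add_apply, Pi.smul_apply, Pi.neg_apply, smul_eq_mul, neg_neg,
    if_true]
  split_ifs with h
  · rw [h, hb]
    ring
  · rw [max_neg_zero]
    ring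

end Reflect

section Compatible

variable {r n : ℕ} {Λ : Matrix (Fin (r + n)) (Fin (r + n)) ℤ} {B : Matrix (Fin (r + n)) (Fin r) ℤ}

/-- The `j`-th column of an extended exchange matrix. -/
def col (B : Matrix (Fin (r + n)) (Fin r) ℤ) (j : Fin r) : Fin (r + n) → ℤ := fun i => B i j

theorem col_apply (j : Fin r) (i : Fin (r + n)) : col B j i = B i j := rfl

/-- Coordinate-free form of compatibility: pairing with column j is d_j times the j-th coordinate
function, so column j is orthogonal to every exponent without j-th coordinate. -/
theorem isCompatiblePair_iff : IsCompatiblePair Λ B ↔ (∀ i j, Λ i j = -Λ j i) ∧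
    ∃ d : Fin r → ℤ, (∀ j, 0 < d j) ∧
      ∀ j c, form Λ (col B j) c = d j * c (Fin.castAdd n j) := by
  unfold IsCompatiblePair
  refine and_congr_right fun _ => exists_congr fun d => and_congr_right fun _ => forall_congr' fun j => ?_
  constructor
  · intro h c
    rw [form_eq_sum, Finset.sum_comm]
    simp only [col_apply]
    have : ∀ i, ∑ k, B k j * c i * Λ k i = c i * if i = Fin.castAdd n j then d j else 0 := by
      intro i
      rw [← h i, Finset.mul_sum]
      exact Finset.sum_congr rfl fun k _ => by ring
    simp only [this, mul_ite, mul_zero, Finset.sum_ite_eq', Finset.mem_univ, if_true]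
    ring
  · intro h i
    have := h (Pi.single i 1)
    rw [form_eq_sum] at this
    simp only [col_apply, Pi.single_apply, mul_ite, mul_one, mul_zero, ite_mul, zero_mul, Finset.sum_ite_eq',
      Finset.mem_univ, if_true] at this
    rw [this]
    split_ifs with h1 h2 h2
    · rfl
    · exact absurd h1.symm h2
    · exact absurd h2.symm h1
    · rfl

theorem matrixE_mulVec (k : Fin r) (c : Fin (r + n) → ℤ) :
    (matrixE B k).mulVec c = reflect (col B k) (Fin.castAdd n k) c := by
  ext a
  rw [reflect_apply, Matrix.mulVec, dotProduct]
  have : ∀ j, matrixE B k a j * c j = (if j = Fin.castAdd n k then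
      (if a = Fin.castAdd n k then -1 else max (-B a k) 0) * c j else 0) +
      (if a = j then (if j = Fin.castAdd n k then 0 else c j) else 0) := by
    intro j
    unfold matrixE
    split_ifs <;> simp
  simp only [this, Finset.sum_add_distrib, Finset.sum_ite_eq, Finset.sum_ite_eq', Finset.mem_univ,
    if_true]
  split_ifs
  · ring
  · rw [col_apply]
    ring

theorem form_mutate (k : Fin r) (c d : Fin (r + n) → ℤ) :
    form ((matrixE B k).transpose * Λ * matrixE B k) c d =
      form Λ (reflect (col B k) (Fin.castAdd n k) c)
        (reflect (col B k) (Fin.castAdd n k) d) := by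
  rw [← matrixE_mulVec k, ← matrixE_mulVec k]
  unfold form
  rw [← Matrix.mulVec_mulVec, ← Matrix.mulVec_mulVec, Matrix.dotProduct_mulVec,
    Matrix.vecMul_transpose]

namespace IsCompatiblePair

theorem skew (h : IsCompatiblePair Λ B) : ∀ i j, Λ i j = -Λ j i := h.1

/-- Pairing column k with itself gives 0 by skew-symmetry and d_k b_kk by compatibility. -/
theorem diag (h : IsCompatiblePair Λ B) (k : Fin r) : col B k (Fin.castAdd n k) = 0 := by
  obtain ⟨h1, d, hd, h2⟩ := isCompatiblePair_iff.1 h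
  have h3 := h2 k (col B k)
  rw [form_self h1] at h3
  exact (mul_eq_zero.1 h3.symm).resolve_left (hd k).ne'

theorem form_col_eq_zero (h : IsCompatiblePair Λ B) (k : Fin r) {c : Fin (r + n) → ℤ}
    (hc : c (Fin.castAdd n k) = 0) : form Λ (col B k) c = 0 := by
  obtain ⟨_, d, _, h2⟩ := isCompatiblePair_iff.1 h
  rw [h2, hc, mul_zero]

theorem form_col_eq_zero' (h : IsCompatiblePair Λ B) (k : Fin r) {c : Fin (r + n) → ℤ}
    (hc : c (Fin.castAdd n k) = 0) : form Λ c (col B k) = 0 := by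
  rw [form_skew h.skew, h.form_col_eq_zero k hc, neg_zero]

theorem symmetrizable (h : IsCompatiblePair Λ B) : ∃ d : Fin r → ℤ, (∀ j, 0 < d j) ∧
    ∀ i j, d j * col B i (Fin.castAdd n j) = -(d i * col B j (Fin.castAdd n i)) := by
  obtain ⟨h1, d, hd, h2⟩ := isCompatiblePair_iff.1 h
  exact ⟨d, hd, fun i j => by rw [← h2, ← h2, form_skew h1]⟩

theorem form_add_smul_col (h : IsCompatiblePair Λ B) (k : Fin r) (c d : Fin (r + n) → ℤ) :
    form Λ (c + -c (Fin.castAdd n k) • col B k) (d + -d (Fin.castAdd n k) • col B k) =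
      form Λ c d + -c (Fin.castAdd n k) * form Λ (col B k) d +
        -d (Fin.castAdd n k) * form Λ c (col B k) := by
  simp only [form_add_left, form_add_right, form_smul_left, form_smul_right, form_self h.skew]
  ring

/-- The two correction terms are c_k d_k times the positive integer attached to column k, with
opposite signs, and cancel. -/
theorem form_sub_smul_col (h : IsCompatiblePair Λ B) (k : Fin r) (c d : Fin (r + n) → ℤ) :
    form Λ (c + -c (Fin.castAdd n k) • col B k) (d + -d (Fin.castAdd n k) • col B k) =
      form Λ c d := by
  obtain ⟨h1, D, _, h2⟩ := isCompatiblePair_iff.1 h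
  rw [h.form_add_smul_col, form_skew h1 c (col B k), h2, h2]
  ring

/-- The two signs of E define the same mutated form: `reflect_neg` relates them by a transvection
along column k, which `form_sub_smul_col` shows to be an isometry. -/
theorem form_reflect_neg (h : IsCompatiblePair Λ B) (k : Fin r) (c d : Fin (r + n) → ℤ) :
    form Λ (reflect (-col B k) (Fin.castAdd n k) c)
      (reflect (-col B k) (Fin.castAdd n k) d) =
    form Λ (reflect (col B k) (Fin.castAdd n k) c)
      (reflect (col B k) (Fin.castAdd n k) d) := by
  rw [reflect_neg _ (h.diag k), reflect_neg _ (h.diag k)]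
  refine Eq.trans ?_ (h.form_sub_smul_col k _ _)
  simp only [reflect_apply, if_true, neg_neg]

end IsCompatiblePair

theorem col_mutateMatrix_self (k : Fin r) : col (mutateMatrix B k) k = -col B k := by
  ext i
  simp [mutateMatrix, col_apply]

theorem col_mutateMatrix_castAdd (k j : Fin r) :
    col (mutateMatrix B k) j (Fin.castAdd n k) = -col B j (Fin.castAdd n k) := by
  simp [mutateMatrix, col_apply]

/-- In the exponents of the old seed, a mutated column differs from the old one only by a multiple
of column k, whose pairings are known. -/
theorem reflect_mutateMatrix (k j : Fin r) (hk : col B k (Fin.castAdd n k) = 0) (hj : j ≠ k) :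
    reflect (col B k) (Fin.castAdd n k) (col (mutateMatrix B k) j) =
      col B j + max (col B j (Fin.castAdd n k)) 0 • col B k := by
  ext a
  simp only [reflect_apply, Pi.add_apply, Pi.smul_apply, smul_eq_mul, col_mutateMatrix_castAdd]
  split_ifs with h
  · rw [h, hk]
    ring
  · rw [col_apply j a, mutateMatrix, if_neg (by tauto)]
    simp only [col_apply, max_neg_zero]
    ring

theorem reflect_neg_mutateMatrix (k j : Fin r) (hk : col B k (Fin.castAdd n k) = 0) (hj : j ≠ k) :
    reflect (-col B k) (Fin.castAdd n k) (col (mutateMatrix B k) j) =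
      col B j + max (-col B j (Fin.castAdd n k)) 0 • col B k := by
  rw [reflect_neg _ hk, reflect_mutateMatrix k j hk hj, col_mutateMatrix_castAdd, max_neg_zero]
  module

theorem mutateMatrix_mutateMatrix (k : Fin r) : mutateMatrix (mutateMatrix B k) k = B := by
  ext i j
  by_cases h : i = Fin.castAdd n k ∨ j = k
  · simp [mutateMatrix, h]
  · have h1 : mutateMatrix B k (Fin.castAdd n k) j = -B (Fin.castAdd n k) j := by simp [mutateMatrix]
    have h2 : mutateMatrix B k i k = -B i k := by simp [mutateMatrix]
    rw [mutateMatrix, if_neg h, h1, h2, mutateMatrix, if_neg h, neg_neg, neg_neg]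
    ring

theorem matrix_ext_form {Λ' : Matrix (Fin (r + n)) (Fin (r + n)) ℤ}
    (h : ∀ c d, form Λ c d = form Λ' c d) : Λ = Λ' := by
  ext i j
  rw [← form_single (Λ := Λ), h, form_single]

namespace IsCompatiblePair

theorem mutate (h : IsCompatiblePair Λ B) (k : Fin r) :
    IsCompatiblePair ((matrixE B k).transpose * Λ * matrixE B k) (mutateMatrix B k) := by
  obtain ⟨h1, d, hd, h2⟩ := isCompatiblePair_iff.1 h
  refine isCompatiblePair_iff.2 ⟨fun i j => ?_, d, hd, fun j c => ?_⟩
  · rw [← form_single (Λ := _ * _) i, ← form_single (Λ := _ * _) j, form_mutate k,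
      form_mutate k, form_skew h1]
  · rw [form_mutate k]
    by_cases hj : j = k
    · subst hj
      rw [col_mutateMatrix_self, reflect_of_eq_zero (c := -col B j) _ (by simp [h.diag j]),
        form_neg_left, h2, reflect_apply, if_pos rfl]
      ring
    · rw [reflect_mutateMatrix k j (h.diag k) hj, form_add_left, form_smul_left, h2, h2,
        reflect_apply, reflect_apply, if_pos rfl, if_neg (by simpa using hj)]
      have h3 : d k * col B j (Fin.castAdd n k) = -(d j * col B k (Fin.castAdd n j)) := by
        rw [← h2, ← h2, form_skew h1]
      -- Skew-symmetrizability turns the negative part of b_jk into the positive part of b_kj, up to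
      -- the weights.
      have h4 : d j * max (-col B k (Fin.castAdd n j)) 0 = d k * max (col B j (Fin.castAdd n k)) 0 := by
        rw [mul_max_of_nonneg _ _ (hd j).le, mul_max_of_nonneg _ _ (hd k).le, h3]
        simp
      linear_combination c (Fin.castAdd n k) * h4

theorem mutate_mutate (h : IsCompatiblePair Λ B) (k : Fin r) :
    (matrixE (mutateMatrix B k) k).transpose * ((matrixE B k).transpose * Λ * matrixE B k) *
      matrixE (mutateMatrix B k) k = Λ := by
  refine matrix_ext_form fun c d => ?_
  rw [form_mutate k, form_mutate k, col_mutateMatrix_self,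
    reflect_reflect_neg _ (h.diag k), reflect_reflect_neg _ (h.diag k), ← h.form_sub_smul_col k]
  congr 1 <;> simp [h.diag k, add_assoc]

end IsCompatiblePair

end Compatible

/-! ### Mutations of toric seeds -/

section Exchange

variable {r n : ℕ} {Λ : Matrix (Fin (r + n)) (Fin (r + n)) ℤ} {B : Matrix (Fin (r + n)) (Fin r) ℤ}

theorem exchangeExponent_sub (b : Fin (r + n) → ℤ) (k : Fin r) :
    exchangeExponent b k - exchangeExponent (-b) k = b := by
  ext i
  simp only [exchangeExponent, Pi.sub_apply, Pi.neg_apply, max_neg_zero]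
  ring

theorem exchangeExponent_self {b : Fin (r + n) → ℤ} {k : Fin r} (hb : b (Fin.castAdd n k) = 0) :
    exchangeExponent b k (Fin.castAdd n k) = -1 := by
  simp [exchangeExponent, hb]

theorem exchangeExponent_apply_of_ne {b : Fin (r + n) → ℤ} {k : Fin r} {i : Fin (r + n)}
    (hi : i ≠ Fin.castAdd n k) : exchangeExponent b k i = max (b i) 0 := by
  simp [exchangeExponent, hi]

theorem reflect_single {b : Fin (r + n) → ℤ} {k : Fin r} (hb : b (Fin.castAdd n k) = 0) :
    reflect b (Fin.castAdd n k) (Pi.single (Fin.castAdd n k) 1) = exchangeExponent (-b) k := by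
  ext i
  by_cases h : i = Fin.castAdd n k
  · subst h
    simp [reflect_apply, exchangeExponent, hb]
  · simp [reflect_apply, exchangeExponent, h]

end Exchange

namespace QuantumSeed

variable {K : Type*} [Field K] {F : Type*} [DivisionRing F] [Algebra (QRing K) F] {r n : ℕ}
  {s : QuantumSeed F r n}

omit [DivisionRing F] in
theorem eq_of_fields {t : QuantumSeed F r n} (hΛ : s.Λ = t.Λ) (hB : s.B = t.B) (hx : s.x = t.x) :
    s = t := by
  cases s
  cases t
  simp_all

theorem mutate_x_self (k : Fin r) : (s.mutate K k).x (Fin.castAdd n k) =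
    s.frame K (exchangeExponent (col s.B k) k) + s.frame K (exchangeExponent (-col s.B k) k) :=
  Function.update_self _ _ _

theorem mutate_x_of_ne {k : Fin r} {i : Fin (r + n)} (hi : i ≠ Fin.castAdd n k) :
    (s.mutate K k).x i = s.x i :=
  Function.update_of_ne hi _ _

theorem mutate_form (k : Fin r) (c d : Fin (r + n) → ℤ) : form (s.mutate K k).Λ c d =
    form s.Λ (reflect (col s.B k) (Fin.castAdd n k) c) (reflect (col s.B k) (Fin.castAdd n k) d) :=
  form_mutate k c d

theorem mutate_frame {k : Fin r} {c : Fin (r + n) → ℤ} (hc : c (Fin.castAdd n k) = 0) :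
    (s.mutate K k).frame K c = s.frame K c := by
  rw [frame_eq, frame_eq]
  congr 1
  · congr 2
    refine Finset.sum_congr rfl fun i _ => Finset.sum_congr rfl fun j _ => ?_
    split_ifs with h
    · by_cases hi : i = Fin.castAdd n k
      · rw [hi, hc, zero_mul, zero_mul, zero_mul]
      by_cases hj : j = Fin.castAdd n k
      · rw [hj, hc, mul_zero, zero_mul, zero_mul]
      congr 1
      rw [← form_single (Λ := (s.mutate K k).Λ), mutate_form, reflect_of_eq_zero,
        reflect_of_eq_zero, form_single]
      · simp [Ne.symm hj]
      · simp [Ne.symm hi]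
    · rfl
  · unfold ordMon
    congr 2
    ext i
    by_cases hi : i = Fin.castAdd n k
    · rw [hi, hc, zpow_zero, zpow_zero]
    · rw [mutate_x_of_ne hi]

namespace IsToric

/-- Compatibility forces column k to be nonzero, so the two exchange monomials are different basis
elements of the based torus and cannot cancel. -/
theorem mutate_x_ne_zero (hs : s.IsToric K) (hinj : Function.Injective hs.toricHom)
    (h : IsCompatiblePair s.Λ s.B) (k : Fin r) : (s.mutate K k).x (Fin.castAdd n k) ≠ 0 := by
  classical
  rw [mutate_x_self, ← hs.toricHom_X, ← hs.toricHom_X, ← map_add]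
  refine (map_ne_zero_iff _ hinj).2 fun h0 => ?_
  have h1 := congrArg (fun x => coeff x (exchangeExponent (col s.B k) k)) h0
  simp only [coeff_add, coeff_zero, QuantumTorus.X, coeff_mono, if_true] at h1
  split_ifs at h1 with h2
  · have h3 : col s.B k = 0 := by
      rw [← exchangeExponent_sub (col s.B k) k, h2, sub_self]
    obtain ⟨_, d, hd, h4⟩ := isCompatiblePair_iff.1 h
    have h5 := h4 k (Pi.single (Fin.castAdd n k) 1)
    rw [h3, form_zero_left, Pi.single_eq_same, mul_one] at h5
    exact (hd k).ne h5
  · rw [add_zero] at h1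
    exact one_ne_zero h1

theorem mutate (hs : s.IsToric K) (hinj : Function.Injective hs.toricHom)
    (h : IsCompatiblePair s.Λ s.B) (k : Fin r) : (s.mutate K k).IsToric K := by
  have hskew : ∀ i j, (s.mutate K k).Λ i j = -(s.mutate K k).Λ j i := (h.mutate k).skew
  have h0 : ∀ i, (s.mutate K k).Λ i i = 0 := fun i => by
    have := hskew i i
    omega
  have h1 : ∀ i, i ≠ Fin.castAdd n k → QComm K (2 * (s.mutate K k).Λ i (Fin.castAdd n k))
      ((s.mutate K k).x i) ((s.mutate K k).x (Fin.castAdd n k)) := by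
    intro i hi
    have h2 : (s.mutate K k).Λ i (Fin.castAdd n k) =
        form s.Λ (Pi.single i 1) (exchangeExponent (-col s.B k) k) := by
      rw [← form_single (Λ := (s.mutate K k).Λ), mutate_form, reflect_single (h.diag k),
        reflect_of_eq_zero]
      simp [Ne.symm hi]
    -- The exponents of the two exchange monomials differ by column k, which is orthogonal to e_i
    -- for i ≠ k. Both monomials thus commute with x_i up to the same power of q.
    have h3 : form s.Λ (Pi.single i 1) (exchangeExponent (-col s.B k) k) =
        form s.Λ (Pi.single i 1) (exchangeExponent (col s.B k) k) := by
      rw [← sub_eq_zero, ← form_sub_right, ← neg_sub, exchangeExponent_sub, form_neg_right,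
        h.form_col_eq_zero' k (by simp [Ne.symm hi]), neg_zero]
    rw [mutate_x_self, mutate_x_of_ne hi, h2, ← frame_single (K := K)]
    refine QComm.add_right ?_ (hs.frame_qComm _ _)
    rw [h3]
    exact hs.frame_qComm _ _
  refine ⟨hskew, fun i => ?_, fun i j => ?_⟩
  · by_cases hi : i = Fin.castAdd n k
    · rw [hi]
      exact hs.mutate_x_ne_zero hinj h k
    · rw [mutate_x_of_ne hi]
      exact hs.ne_zero i
  · by_cases hi : i = Fin.castAdd n k
    · by_cases hj : j = Fin.castAdd n k
      · rw [hi, hj, h0]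
        simp [QComm, qHalf_zero]
      · have := (h1 j hj).symm
        rw [hi, hskew]
        convert this using 1
        ring
    · by_cases hj : j = Fin.castAdd n k
      · rw [hj]
        exact h1 i hi
      · rw [mutate_x_of_ne hi, mutate_x_of_ne hj]
        convert hs.comm i j using 2
        rw [← form_single (Λ := (s.mutate K k).Λ), mutate_form, reflect_of_eq_zero,
          reflect_of_eq_zero, form_single]
        · simp [Ne.symm hj]
        · simp [Ne.symm hi]

theorem mutate_mutate (hs : s.IsToric K) (hinj : Function.Injective hs.toricHom)
    (h : IsCompatiblePair s.Λ s.B) (k : Fin r) : (s.mutate K k).mutate K k = s := by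
  have hx : ∀ i, ((s.mutate K k).mutate K k).x i = s.x i := by
    intro i
    by_cases hi : i = Fin.castAdd n k
    · subst hi
      have hs' := hs.mutate hinj h k
      have hb : col (s.mutate K k).B k = -col s.B k := col_mutateMatrix_self k
      -- Both sides are the same multiple of M(g) with g_k = 0, where the old and new frames agree.
      -- Adding the two cases gives x_k' x_k'' = x_k' x_k, where x_k' and x_k'' are the k-th
      -- variables after one and two mutations, and x_k' is cancelled.
      have key : ∀ b : Fin (r + n) → ℤ, (b = col s.B k ∨ b = -col s.B k) →
          (s.mutate K k).x (Fin.castAdd n k) * (s.mutate K k).frame K (exchangeExponent b k) =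
            s.frame K (exchangeExponent b k) * s.x (Fin.castAdd n k) := by
        intro b hb
        set e : Fin (r + n) → ℤ := Pi.single (Fin.castAdd n k) 1 with he
        have hek : e (Fin.castAdd n k) = 1 := Pi.single_eq_same _ _
        have hbk : b (Fin.castAdd n k) = 0 := by
          rcases hb with rfl | rfl <;> simp [h.diag k]
        obtain ⟨g, hg⟩ : ∃ g, g = exchangeExponent b k + e := ⟨_, rfl⟩
        have hgk : g (Fin.castAdd n k) = 0 := by
          rw [hg, Pi.add_apply, exchangeExponent_self hbk, hek]
          rfl
        have hg' : exchangeExponent b k = g - e := by rw [hg, add_sub_cancel_right]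
        have h1 := hs'.frame_mul e (exchangeExponent b k)
        have h2 := hs.frame_mul (exchangeExponent b k) e
        rw [he, frame_single, ← he] at h1 h2
        rw [h1, h2, add_comm e, ← hg, mutate_frame hgk]
        congr 2
        rw [mutate_form, hg', map_sub, form_sub_left, form_sub_right, form_self hs.skew,
          form_self hs.skew, sub_zero, sub_zero, reflect_of_eq_zero _ hgk, he,
          reflect_single (h.diag k)]
        have h3 : form s.Λ (exchangeExponent (-col s.B k) k) g =
            form s.Λ (exchangeExponent b k) g := by
          rcases hb with rfl | rfl
          · rw [← sub_eq_zero, ← form_sub_left, ← neg_sub, exchangeExponent_sub, form_neg_left,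
              h.form_col_eq_zero k hgk, neg_zero]
          · rfl
        rw [h3, hg', form_sub_left, form_self hs.skew, form_skew hs.skew, ← he]
        ring
      have h4 := hs'.ne_zero (Fin.castAdd n k)
      rw [mutate_x_self, hb, neg_neg]
      apply mul_left_cancel₀ h4
      rw [mul_add, key _ (Or.inr rfl), key _ (Or.inl rfl), ← add_mul, add_comm, ← mutate_x_self]
    · rw [mutate_x_of_ne hi, mutate_x_of_ne hi]
  have hΛ : ((s.mutate K k).mutate K k).Λ = s.Λ := h.mutate_mutate k
  have hB : ((s.mutate K k).mutate K k).B = s.B := mutateMatrix_mutateMatrix k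
  exact eq_of_fields hΛ hB (funext hx)

end IsToric

end QuantumSeed

/-! ### Intersections of quantum tori -/

theorem QuantumTorus.exists_bound {K : Type*} [Field K] {m : ℕ} {Λ : Matrix (Fin m) (Fin m) ℤ}
    (g : QuantumTorus K Λ) : ∃ N : ℕ, SuppIn (fun e => ∀ i, -(N : ℤ) ≤ e i) g := by
  obtain ⟨N, hN⟩ := exists_box g.finite_coeff.toFinset
  exact ⟨N, fun e he i => (mem_box.1 (hN (by simpa using he)) i).1⟩

namespace QuantumSeed

variable {K : Type*} [Field K] {F : Type*} [DivisionRing F] [Algebra (QRing K) F] {r n : ℕ}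
  {s : QuantumSeed F r n}

namespace IsToric

theorem x_pow_mul_frame (hs : s.IsToric K) (i : Fin (r + n)) (N : ℕ) (e : Fin (r + n) → ℤ) :
    ∃ a, s.x i ^ N * s.frame K e = qHalf K a • s.frame K (Pi.single i (N : ℤ) + e) := by
  refine ⟨form s.Λ (Pi.single i (N : ℤ)) e, ?_⟩
  rw [← hs.frame_mul, frame_single_zpow, zpow_natCast]

theorem frame_eq_x_pow_mul (hs : s.IsToric K) (i : Fin (r + n)) {c : Fin (r + n) → ℤ}
    {N : ℕ} (hN : c i = N) :
    ∃ a e, e i = 0 ∧ s.frame K c = qHalf K a • (s.x i ^ N * s.frame K e) := by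
  refine ⟨-form s.Λ (Pi.single i (N : ℤ)) (c - Pi.single i (N : ℤ)), c - Pi.single i (N : ℤ),
    by simp [hN], ?_⟩
  rw [← zpow_natCast, ← frame_single_zpow (K := K), ← hs.frame_add, add_sub_cancel]

end IsToric

section Intersection

variable (hs : s.IsToric K) (hinj : Function.Injective hs.toricHom)
  (h : IsCompatiblePair s.Λ s.B) (i : Fin r)

include hs hinj h in
-- Mutation is involutive, so x_i is the i-th variable of the mutation of μ_i s, that is, a sum of
-- two frame elements of μ_i s.
theorem x_mem_torus_mutate (j : Fin (r + n)) : s.x j ∈ (s.mutate K i).torus K := by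
  by_cases hj : j = Fin.castAdd n i
  · subst hj
    rw [← hs.mutate_mutate hinj h i, mutate_x_self, hs.mutate_mutate hinj h i]
    exact add_mem (frame_mem_torus _) (frame_mem_torus _)
  · rw [← mutate_x_of_ne (K := K) hj]
    exact x_mem_torus j

include hs hinj h in
theorem x_zpow_mem_torus_mutate {j : Fin (r + n)} {a : ℤ} (ha : j = Fin.castAdd n i → 0 ≤ a) :
    s.x j ^ a ∈ (s.mutate K i).torus K := by
  by_cases hj : j = Fin.castAdd n i
  · obtain ⟨a, rfl⟩ := Int.eq_ofNat_of_zero_le (ha hj)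
    rw [zpow_natCast]
    exact pow_mem (x_mem_torus_mutate hs hinj h i j) a
  · rw [← mutate_x_of_ne (K := K) hj]
    exact x_zpow_mem_torus j a

/-- The elements of the based quantum torus that are mapped to `T_qM_i`. -/
def mutateComap : Subalgebra (QRing K) (QuantumTorus K s.Λ) :=
  ((s.mutate K i).torus K).comap hs.toricHom

theorem mem_mutateComap {f : QuantumTorus K s.Λ} :
    f ∈ mutateComap hs i ↔ hs.toricHom f ∈ (s.mutate K i).torus K := Iff.rfl

include hinj h

theorem X_mem_mutateComap {c : Fin (r + n) → ℤ} (hc : 0 ≤ c (Fin.castAdd n i)) :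
    QuantumTorus.X K s.Λ c ∈ mutateComap hs i := by
  rw [mem_mutateComap, hs.toricHom_X]
  exact frame_mem fun j => x_zpow_mem_torus_mutate hs hinj h i fun hj => hj ▸ hc

theorem mem_mutateComap_of_suppIn {f : QuantumTorus K s.Λ}
    (hf : SuppIn (fun e => 0 ≤ e (Fin.castAdd n i)) f) : f ∈ mutateComap hs i := by
  refine induct_suppIn hf (zero_mem _) (fun x y hx hy => add_mem hx hy) fun e a he => ?_
  have := (mutateComap hs i).smul_mem (X_mem_mutateComap hs hinj h i he) a
  rwa [QuantumTorus.X, smul_mono, mul_one] at this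

/-- A monomial without i-th exponent has its inverse in the subalgebra as well. -/
theorem mem_of_X_mul_mem {c : Fin (r + n) → ℤ} (hc : c (Fin.castAdd n i) = 0)
    {f : QuantumTorus K s.Λ} (hf : QuantumTorus.X K s.Λ c * f ∈ mutateComap hs i) :
    f ∈ mutateComap hs i := by
  have h1 : QuantumTorus.X K s.Λ (-c) ∈ mutateComap hs i :=
    X_mem_mutateComap hs hinj h i (by simp [hc])
  have h2 := mul_mem h1 hf
  rw [← mul_assoc, X_mul_X, neg_add_cancel, form_neg_left, form_self hs.skew, neg_zero, qHalf_zero,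
    one_smul] at h2
  simpa [QuantumTorus.X, ← one_eq] using h2

omit hinj h

/-- The element of the based quantum torus that represents `M_i(e_i)`. -/
def exchangeElt : QuantumTorus K s.Λ :=
  QuantumTorus.X K s.Λ (exchangeExponent (col s.B i) i) +
    QuantumTorus.X K s.Λ (exchangeExponent (-col s.B i) i)

theorem toricHom_exchangeElt :
    hs.toricHom (exchangeElt i) = (s.mutate K i).x (Fin.castAdd n i) := by
  rw [exchangeElt, map_add, hs.toricHom_X, hs.toricHom_X, mutate_x_self]

theorem exchangeElt_mem : exchangeElt i ∈ mutateComap hs i := by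
  rw [mem_mutateComap, toricHom_exchangeElt]
  exact x_mem_torus _

include hinj h

theorem mem_of_exchangeElt_mul_mem {f : QuantumTorus K s.Λ}
    (hf : exchangeElt i * f ∈ mutateComap hs i) : f ∈ mutateComap hs i := by
  rw [mem_mutateComap, map_mul, toricHom_exchangeElt] at hf
  have h1 := mul_mem (x_inv_mem_torus (K := K) (s := s.mutate K i) (Fin.castAdd n i)) hf
  rwa [← mul_assoc, inv_mul_cancel₀ (hs.mutate_x_ne_zero hinj h i), one_mul] at h1

theorem mem_of_exchangeElt_pow_mul_mem {f : QuantumTorus K s.Λ} (N : ℕ)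
    (hf : exchangeElt i ^ N * f ∈ mutateComap hs i) : f ∈ mutateComap hs i := by
  induction N with
  | zero => simpa using hf
  | succ N ih =>
    rw [pow_succ', mul_assoc] at hf
    exact ih (mem_of_exchangeElt_mul_mem hs hinj h i hf)

/-- A power of the i-th variable of μ_i s clears all negative exponents of that variable. What
remains are combinations of elements `exchangeElt i ^ M * X^c` with c_i = 0. These are homogeneous
because φ vanishes on column i, so taking components only selects some of them. -/
theorem comp_mem_mutateComap {φ : (Fin (r + n) → ℤ) →+ ℤ} (hφ : φ (col s.B i) = 0)
    {f : QuantumTorus K s.Λ} (hf : f ∈ mutateComap hs i) (d : ℤ) :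
    comp φ d f ∈ mutateComap hs i := by
  have hs' := hs.mutate hinj h i
  set D := φ (exchangeExponent (-col s.B i) i) with hD
  have hv : SuppIn (fun e => φ e = D) (exchangeElt (K := K) (s := s) i) := by
    refine SuppIn.add (SuppIn.mono ?_ 1) (SuppIn.mono hD.symm 1)
    rw [hD, ← sub_eq_zero, ← map_sub, exchangeExponent_sub, hφ]
  have hvp : ∀ N : ℕ, SuppIn (fun e => φ e = N * D) (exchangeElt (K := K) (s := s) i ^ N) := by
    intro N
    induction N with
    | zero =>
      rw [pow_zero, one_eq]
      exact SuppIn.mono (by simp) 1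
    | succ N ih =>
      rw [pow_succ]
      refine ih.mul hv fun e f he hf => ?_
      rw [map_add, he, hf]
      push_cast
      ring
  obtain ⟨g, hg⟩ := hs'.mem_torus_iff.1 hf
  obtain ⟨N, hN⟩ := g.exists_bound
  have key : ∃ f', hs.toricHom f' = (s.mutate K i).x (Fin.castAdd n i) ^ N * hs'.toricHom g ∧
      ∀ d, comp φ d f' ∈ mutateComap hs i := by
    refine induct_suppIn (C := fun g => ∃ f', hs.toricHom f' =
      (s.mutate K i).x (Fin.castAdd n i) ^ N * hs'.toricHom g ∧ ∀ d, comp φ d f' ∈ mutateComap hs i)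
      hN ⟨0, by simp, fun d => ?_⟩ ?_ fun e a he => ?_
    · rw [comp_of_suppIn SuppIn.zero]
      exact zero_mem _
    · rintro x y ⟨f', hf', hx⟩ ⟨f'', hf'', hy⟩
      refine ⟨f' + f'', by rw [map_add, map_add, hf', hf'', mul_add], fun d => ?_⟩
      rw [comp_add]
      exact add_mem (hx d) (hy d)
    · obtain ⟨α, hα⟩ := hs'.x_pow_mul_frame (Fin.castAdd n i) N e
      obtain ⟨M, hM⟩ : ∃ M : ℕ,
          (Pi.single (Fin.castAdd n i) (N : ℤ) + e : Fin (r + n) → ℤ) (Fin.castAdd n i) = M := by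
        refine Int.eq_ofNat_of_zero_le ?_
        rw [Pi.add_apply, Pi.single_eq_same]
        have := he (Fin.castAdd n i)
        omega
      obtain ⟨β, c, hc, hβ⟩ := hs'.frame_eq_x_pow_mul (Fin.castAdd n i) hM
      rw [mutate_frame hc] at hβ
      have h1 : hs.toricHom (a • qHalf K α • qHalf K β • (exchangeElt i ^ M * QuantumTorus.X K s.Λ c))
          = (s.mutate K i).x (Fin.castAdd n i) ^ N * hs'.toricHom (mono _ e a) := by
        rw [hs'.toricHom_mono, mul_smul_comm, hα, hβ, map_smul, map_smul, map_smul, map_mul,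
          map_pow, toricHom_exchangeElt, hs.toricHom_X]
      refine ⟨_, h1, fun d => ?_⟩
      have h2 : SuppIn (fun e => φ e = M * D + φ c)
          (a • qHalf K α • qHalf K β • (exchangeElt i ^ M * QuantumTorus.X K s.Λ c)) := by
        refine ((((hvp M).mul (SuppIn.mono (P := fun e => φ e = φ c) rfl 1)
          fun e f he hf => ?_).smul _).smul _).smul _
        rw [map_add, he, hf]
      by_cases hd : d = M * D + φ c
      · subst hd
        rw [comp_of_suppIn h2, mem_mutateComap, h1]
        exact mul_mem (pow_mem (x_mem_torus _) _) (hs'.toricHom_mem_torus _)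
      · rw [comp_of_suppIn_ne (h2.imp fun e he => he.trans_ne (Ne.symm hd))]
        exact zero_mem _
  obtain ⟨f', hf', hf''⟩ := key
  have h3 : exchangeElt i ^ N * f = f' := by
    apply hinj
    rw [hf', map_mul, map_pow, toricHom_exchangeElt, hg]
    rfl
  -- The clearing factor is homogeneous, so it can be pulled out of the component, and its image is
  -- invertible in T(μ_i s).
  refine mem_of_exchangeElt_pow_mul_mem hs hinj h i N ?_
  rw [← comp_mul (hvp N), h3]
  exact hf'' _

end Intersection

/-! ### Lowest components of mutated frame monomials -/

section Low

variable (hs : s.IsToric K) (hinj : Function.Injective hs.toricHom)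
  (h : IsCompatiblePair s.Λ s.B) {k : Fin r} {b : Fin (r + n) → ℤ}
  (hb : b = col s.B k ∨ b = -col s.B k)

include h hb in
theorem mutate_form_of_eq_or_eq_neg (c d : Fin (r + n) → ℤ) : form (s.mutate K k).Λ c d =
    form s.Λ (reflect b (Fin.castAdd n k) c) (reflect b (Fin.castAdd n k) d) := by
  rcases hb with rfl | rfl
  · exact mutate_form k c d
  · rw [h.form_reflect_neg]
    exact mutate_form k c d

omit [DivisionRing F] [Algebra (QRing K) F] in
include hb in
theorem exchangeElt_eq_of_eq_or_eq_neg : exchangeElt (K := K) (s := s) k =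
    QuantumTorus.X K s.Λ (exchangeExponent (-b) k) +
      QuantumTorus.X K s.Λ (exchangeExponent b k) := by
  rcases hb with rfl | rfl
  · exact add_comm _ _
  · rw [neg_neg]
    rfl

omit [DivisionRing F] [Algebra (QRing K) F] in
include hb in
theorem hasLow_exchangeElt {φ : (Fin (r + n) → ℤ) →+ ℤ} (hφ : 0 < φ b) :
    HasLow φ (φ (exchangeExponent (-b) k)) (exchangeElt (K := K) (s := s) k)
      (QuantumTorus.X K s.Λ (exchangeExponent (-b) k)) := by
  rw [exchangeElt_eq_of_eq_or_eq_neg hb]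
  refine (HasLow.mono _ _).add_higher (SuppIn.mono ?_ _)
  have : φ (exchangeExponent b k) - φ (exchangeExponent (-b) k) = φ b := by
    rw [← map_sub, exchangeExponent_sub]
  omega

include hinj h hb

/-- The lowest component of a frame monomial of the mutated seed. -/
theorem exists_hasLow_frame {φ : (Fin (r + n) → ℤ) →+ ℤ} (hφ : 0 < φ b) {c : Fin (r + n) → ℤ}
    (hc : 0 ≤ c (Fin.castAdd n k)) : ∃ g, hs.toricHom g = (s.mutate K k).frame K c ∧
      HasLow φ (φ (reflect b (Fin.castAdd n k) c)) g
        (QuantumTorus.X K s.Λ (reflect b (Fin.castAdd n k) c)) := by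
  have hbk : b (Fin.castAdd n k) = 0 := by
    rcases hb with rfl | rfl <;> simp [h.diag k]
  have hs' := hs.mutate hinj h k
  obtain ⟨N, hN⟩ := Int.eq_ofNat_of_zero_le hc
  clear hc
  induction N generalizing c with
  | zero =>
    refine ⟨QuantumTorus.X K s.Λ c, ?_, ?_⟩
    · rw [hs.toricHom_X, mutate_frame hN]
    · rw [reflect_of_eq_zero _ hN]
      exact HasLow.mono _ _
  | succ N ih =>
    set e : Fin (r + n) → ℤ := Pi.single (Fin.castAdd n k) 1 with he
    obtain ⟨g, hg, hlow⟩ := ih (c := c - e) (by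
      rw [Pi.sub_apply, hN, he, Pi.single_eq_same]
      push_cast
      ring)
    refine ⟨qHalf K (-form (s.mutate K k).Λ (c - e) e) • (g * exchangeElt k), ?_, ?_⟩
    · have h1 := hs'.frame_add (c - e) e
      rw [sub_add_cancel] at h1
      rw [map_smul, map_mul, hg, toricHom_exchangeElt, h1, he, frame_single]
    · have h1 := (hlow.mul (hasLow_exchangeElt (K := K) hb hφ)).smul
        (qHalf K (-form (s.mutate K k).Λ (c - e) e))
      -- The power of q from multiplying the lowest monomials cancels the normalization of the new
      -- frame exactly, because the mutated form is the pullback of Λ along `reflect b` for either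
      -- sign of `b`.
      rw [X_mul_X, ← reflect_single hbk, ← map_add, ← map_add, ← he, sub_add_cancel,
        ← mutate_form_of_eq_or_eq_neg (K := K) h hb, smul_smul, ← qHalf_add, neg_add_cancel, qHalf_zero,
        one_smul] at h1
      exact h1

end Low

end QuantumSeed

namespace QuantumSeed

variable {K : Type*} [Field K] {F : Type*} [DivisionRing F] [Algebra (QRing K) F] {r n : ℕ}
  {s : QuantumSeed F r n}

/-! ### The inclusion T(s) ∩ T(μ_i μ_k s) ⊆ T(μ_i s) -/

section Key

variable (hs : s.IsToric K) (hinj : Function.Injective hs.toricHom)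
  (h : IsCompatiblePair s.Λ s.B) {k i : Fin r} (hki : k ≠ i) {b : Fin (r + n) → ℤ}

omit [DivisionRing F] [Algebra (QRing K) F] in
include h hki in
/-- A grading that separates the exchange monomials in the direction `k`, but not those in the
direction `i`. -/
theorem exists_separating_grading : ∃ (φ : (Fin (r + n) → ℤ) →+ ℤ) (b : Fin (r + n) → ℤ),
    (b = col s.B k ∨ b = -col s.B k) ∧ φ (col s.B i) = 0 ∧ 0 < φ b ∧ 0 ≤ b (Fin.castAdd n i) ∧
    reflect b (Fin.castAdd n k) (col (mutateMatrix s.B k) i) = col s.B i ∧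
    ((∀ e, φ e = e (Fin.castAdd n i)) ∨
      (col s.B k (Fin.castAdd n i) = 0 ∧ col s.B i (Fin.castAdd n k) = 0)) := by
  obtain ⟨d, hd, hsymm⟩ := h.symmetrizable
  have h1 := hsymm i k
  have hp : reflect (col s.B k) (Fin.castAdd n k) (col (mutateMatrix s.B k) i) =
      col s.B i + max (col s.B i (Fin.castAdd n k)) 0 • col s.B k :=
    reflect_mutateMatrix k i (h.diag k) hki.symm
  have hm : reflect (-col s.B k) (Fin.castAdd n k) (col (mutateMatrix s.B k) i) =
      col s.B i + max (-col s.B i (Fin.castAdd n k)) 0 • col s.B k :=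
    reflect_neg_mutateMatrix k i (h.diag k) hki.symm
  have hdk := hd k
  have hdi := hd i
  -- If b_ik ≠ 0, the grading is the i-th coordinate and the sign of `b` makes b_i positive. As b_ki
  -- then has the sign opposite to b_ik, the correction term in the reflected column vanishes.
  rcases lt_trichotomy (col s.B k (Fin.castAdd n i)) 0 with h2 | h2 | h2
  · refine ⟨Pi.evalAddMonoidHom _ (Fin.castAdd n i), -col s.B k, Or.inr rfl, h.diag i, ?_, ?_, ?_,
      Or.inl fun e => rfl⟩
    · simpa using h2
    · simpa using h2.le
    · rw [hm, max_eq_right, zero_smul, add_zero]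
      by_contra h3
      nlinarith
  · have h3 : col s.B i (Fin.castAdd n k) = 0 := by
      rw [h2, mul_zero, neg_zero] at h1
      exact (mul_eq_zero.1 h1).resolve_left hdk.ne'
    -- If b_ik = 0, the grading is a 2 × 2 minor with column i as first argument, up to the sign of
    -- `b`. Were all minors zero, pairing the proportionality relations with e_k would kill column
    -- i, contrary to compatibility.
    have h4 : ∃ p q, col s.B i p * col s.B k q - col s.B i q * col s.B k p ≠ 0 := by
      by_contra! h4
      obtain ⟨_, D, hD, hform⟩ := isCompatiblePair_iff.1 h
      have h5 : ∀ p, col s.B i p = 0 := by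
        intro p
        have h6 : col s.B i p • col s.B k = col s.B k p • col s.B i := by
          ext q
          simp only [Pi.smul_apply, smul_eq_mul]
          linarith [h4 p q]
        have h7 := congrArg (fun e => form s.Λ e (Pi.single (Fin.castAdd n k) 1)) h6
        simp only [form_smul_left, hform, Pi.single_eq_same] at h7
        rw [Pi.single_eq_of_ne (by simpa using hki.symm)] at h7
        simpa [(hD k).ne'] using h7
      have h6 := hform i (Pi.single (Fin.castAdd n i) 1)
      rw [show col s.B i = 0 from funext h5, form_zero_left, Pi.single_eq_same, mul_one] at h6
      exact (hD i).ne h6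
    obtain ⟨p, q, hpq⟩ := h4
    let ψ : (Fin (r + n) → ℤ) →+ ℤ :=
      (AddMonoidHom.mulLeft (col s.B i p)).comp (Pi.evalAddMonoidHom _ q) -
        (AddMonoidHom.mulLeft (col s.B i q)).comp (Pi.evalAddMonoidHom _ p)
    have hψ : ∀ e, ψ e = col s.B i p * e q - col s.B i q * e p := fun e => rfl
    have hψi : ψ (col s.B i) = 0 := by
      rw [hψ]
      ring
    rcases lt_or_gt_of_ne hpq with h5 | h5
    · refine ⟨ψ, -col s.B k, Or.inr rfl, hψi, ?_, ?_, ?_, Or.inr ⟨h2, h3⟩⟩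
      · rw [map_neg, hψ]
        linarith
      · rw [Pi.neg_apply, h2, neg_zero]
      · rw [hm, h3, neg_zero, max_self, zero_smul, add_zero]
    · refine ⟨ψ, col s.B k, Or.inl rfl, hψi, ?_, ?_, ?_, Or.inr ⟨h2, h3⟩⟩
      · rw [hψ]
        exact h5
      · rw [h2]
      · rw [hp, h3, max_self, zero_smul, add_zero]
  · refine ⟨Pi.evalAddMonoidHom _ (Fin.castAdd n i), col s.B k, Or.inl rfl, h.diag i, h2, h2.le, ?_,
      Or.inl fun e => rfl⟩
    rw [hp, max_eq_right, zero_smul, add_zero]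
    by_contra h3
    nlinarith

include hinj h hki

/-- The element of the based quantum torus of `s` that represents the `i`-th variable of the cluster
of `μ_i μ_k s`. -/
theorem exists_mutate_mutate_x : ∃ (φ : (Fin (r + n) → ℤ) →+ ℤ) (b : Fin (r + n) → ℤ),
    (b = col s.B k ∨ b = -col s.B k) ∧ φ (col s.B i) = 0 ∧ 0 < φ b ∧ 0 ≤ b (Fin.castAdd n i) ∧
    ∃ w d a c, hs.toricHom w = ((s.mutate K k).mutate K i).x (Fin.castAdd n i) ∧
      w ∈ mutateComap hs i ∧ c (Fin.castAdd n i) = 0 ∧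
      HasLow φ d w (qHalf K a • (QuantumTorus.X K s.Λ c * exchangeElt i)) := by
  obtain ⟨φ, b, hb, hφi, hφb, hbi, hrefl, hcase⟩ := exists_separating_grading h hki
  refine ⟨φ, b, hb, hφi, hφb, hbi, ?_⟩
  set κ := Fin.castAdd n k
  set ι := Fin.castAdd n i with hι
  have hικ : ι ≠ κ := by simpa [ι, κ] using hki.symm
  set b₁ := col (mutateMatrix s.B k) i with hb₁
  have hb₁i : b₁ ι = 0 := (h.mutate k).diag i
  obtain ⟨g₁, hg₁, hlow₁⟩ := exists_hasLow_frame hs hinj h hb hφb (c := exchangeExponent b₁ i)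
    (by rw [exchangeExponent_apply_of_ne hικ.symm]; exact le_max_right _ _)
  obtain ⟨g₂, hg₂, hlow₂⟩ := exists_hasLow_frame hs hinj h hb hφb (c := exchangeExponent (-b₁) i)
    (by rw [exchangeExponent_apply_of_ne hικ.symm]; exact le_max_right _ _)
  set r₁ := reflect b κ (exchangeExponent b₁ i) with hr₁
  set r₂ := reflect b κ (exchangeExponent (-b₁) i) with hr₂
  -- The lowest exponents of the two exchange monomials differ by column i. They have the same
  -- degree, and the lowest monomials add up to a shifted exchange element of `s`.
  have hr : r₁ - r₂ = col s.B i := by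
    rw [hr₁, hr₂, ← map_sub, exchangeExponent_sub, hrefl]
  have hφr : φ r₂ = φ r₁ := by
    have h1 := hφi
    rw [← hr, map_sub] at h1
    omega
  rw [hφr] at hlow₂
  have hr₁i : r₁ ι = -1 := by
    rw [hr₁, reflect_apply, if_neg hικ, exchangeExponent_self hb₁i, max_eq_right (by simpa using hbi)]
    ring
  set c := r₁ - exchangeExponent (col s.B i) i with hc
  have hci : c ι = 0 := by
    rw [hc, Pi.sub_apply, hr₁i, exchangeExponent_self (h.diag i)]
    rfl
  have hc₁ : r₁ = c + exchangeExponent (col s.B i) i := by rw [hc, sub_add_cancel]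
  have hc₂ : r₂ = c + exchangeExponent (-col s.B i) i := by
    have h1 := hr.trans (exchangeExponent_sub (col s.B i) i).symm
    rw [sub_eq_iff_eq_add] at h1
    rw [hc, h1]
    abel
  set a := -form s.Λ c (exchangeExponent (col s.B i) i) with ha
  have ha₂ : a = -form s.Λ c (exchangeExponent (-col s.B i) i) := by
    rw [ha, neg_inj, ← sub_eq_zero, ← form_sub_right, exchangeExponent_sub,
      h.form_col_eq_zero' i hci]
  have hX : QuantumTorus.X K s.Λ r₁ + QuantumTorus.X K s.Λ r₂ =
      qHalf K a • (QuantumTorus.X K s.Λ c * exchangeElt i) := by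
    rw [exchangeElt, mul_add, X_mul_X, X_mul_X, smul_add, smul_smul, smul_smul, ← qHalf_add,
      ← qHalf_add, ← hc₁, ← hc₂, ha, neg_add_cancel, ← ha, ha₂, neg_add_cancel, qHalf_zero,
      one_smul, one_smul]
  have hw : hs.toricHom (g₁ + g₂) = ((s.mutate K k).mutate K i).x (Fin.castAdd n i) := by
    rw [map_add, hg₁, hg₂, mutate_x_self]
    rfl
  have hlow := hlow₁.add hlow₂
  rw [hX] at hlow
  refine ⟨g₁ + g₂, φ r₁, a, c, hw, ?_, hci, hlow⟩
  -- If φ is the i-th coordinate, the lowest degree is -1, so all higher terms have nonnegative i-th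
  -- exponent. Otherwise the directions i and k are decoupled, and the element represents the i-th
  -- variable of μ_i s itself.
  rcases hcase with hcase | ⟨hz, hz'⟩
  · rw [← add_sub_cancel (qHalf K a • (QuantumTorus.X K s.Λ c * exchangeElt i)) (g₁ + g₂)]
    refine add_mem (Subalgebra.smul_mem _ (mul_mem (X_mem_mutateComap hs hinj h i hci.ge)
      (exchangeElt_mem hs i)) _) (mem_mutateComap_of_suppIn hs hinj h i (hlow.higher.imp fun e he => ?_))
    rw [hcase, hcase, hr₁i] at he
    exact Int.le_of_sub_one_lt (by simpa using he)
  · have hbb : b₁ = col s.B i := by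
      rw [← hrefl, reflect_of_eq_zero]
      rw [hb₁, col_mutateMatrix_castAdd, hz', neg_zero]
    rw [mem_mutateComap, hw, mutate_x_self]
    have hB : col (s.mutate K k).B i = col s.B i := hbb
    rw [hB, mutate_frame, mutate_frame, ← mutate_x_self]
    · exact x_mem_torus _
    · rw [exchangeExponent_apply_of_ne hικ.symm, Pi.neg_apply, hz', neg_zero, max_self]
    · rw [exchangeExponent_apply_of_ne hικ.symm, hz', max_self]

/-- Powers of the i-th and k-th variables of μ_i μ_k s clear the negative exponents in these two
variables. Both variables lie in T(μ_i s), as do the remaining ones and their inverses, so the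
product lies there. The powers are then divided out by comparing lowest components. -/
theorem torus_inf_torus_mutate_mutate_le
    (hinj₁ : Function.Injective (hs.mutate hinj h k).toricHom) :
    s.torus K ⊓ ((s.mutate K k).mutate K i).torus K ≤ (s.mutate K i).torus K := by
  rintro z ⟨hz₁, hz₂⟩
  obtain ⟨f, rfl⟩ := hs.mem_torus_iff.1 hz₁
  have hs₂ := (hs.mutate hinj h k).mutate hinj₁ (h.mutate k) i
  obtain ⟨g, hg⟩ := hs₂.mem_torus_iff.1 hz₂
  obtain ⟨N, hN⟩ := g.exists_bound
  obtain ⟨φ, b, hb, hφi, hφb, hbi, w, d, a, c, hw, hwE, hci, hlow⟩ :=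
    exists_mutate_mutate_x hs hinj h hki
  have hικ : Fin.castAdd n i ≠ Fin.castAdd n k := by simpa using hki.symm
  have hgr := fun f hf n => comp_mem_mutateComap hs hinj h i hφi (f := f) hf n
  have hvE : exchangeElt k ∈ mutateComap hs i := by
    rw [exchangeElt_eq_of_eq_or_eq_neg hb]
    refine add_mem (X_mem_mutateComap hs hinj h i ?_) (X_mem_mutateComap hs hinj h i ?_) <;>
    · rw [exchangeExponent_apply_of_ne hικ]
      exact le_max_right _ _
  -- The lowest monomial has i-th exponent [-b_i]₊, which is 0 by the choice of the sign of `b`.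
  have hsat_v : ∀ f, exchangeElt k * f ∈ mutateComap hs i → f ∈ mutateComap hs i := by
    refine mem_of_mul_mem hgr (hasLow_exchangeElt hb hφb) hvE fun f hf => ?_
    refine mem_of_X_mul_mem hs hinj h i ?_ hf
    rw [exchangeExponent_apply_of_ne hικ]
    simpa using hbi
  -- The lowest component is a unit scalar times a monomial without i-th exponent times the exchange
  -- element in direction i, and each factor can be divided out.
  have hsat_w : ∀ f, w * f ∈ mutateComap hs i → f ∈ mutateComap hs i := by
    refine mem_of_mul_mem hgr hlow hwE fun f hf => ?_
    refine mem_of_exchangeElt_mul_mem hs hinj h i (mem_of_X_mul_mem hs hinj h i hci ?_)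
    have := (mutateComap hs i).smul_mem hf (qHalf K (-a))
    rwa [smul_mul_assoc, smul_smul, ← qHalf_add, neg_add_cancel, qHalf_zero, one_smul,
      mul_assoc] at this
  have hpow : ∀ g : QuantumTorus K s.Λ, (∀ f, g * f ∈ mutateComap hs i → f ∈ mutateComap hs i) →
      ∀ (N : ℕ) (f), g ^ N * f ∈ mutateComap hs i → f ∈ mutateComap hs i := by
    intro g hg N f hf
    induction N with
    | zero => simpa using hf
    | succ N ih =>
      rw [pow_succ', mul_assoc] at hf
      exact ih (hg _ hf)
  rw [← mem_mutateComap]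
  refine hpow _ hsat_v N _ (hpow _ hsat_w N _ ?_)
  have hxk : ((s.mutate K k).mutate K i).x (Fin.castAdd n k) = hs.toricHom (exchangeElt k) := by
    rw [mutate_x_of_ne hικ.symm, toricHom_exchangeElt]
  rw [mem_mutateComap, map_mul, map_mul, map_pow, map_pow, hw, ← hxk]
  change _ * (_ * (hs.toricHom f)) ∈ _
  change _ = hs.toricHom f at hg
  rw [← hg]
  refine induct_suppIn (C := fun g => ((s.mutate K k).mutate K i).x (Fin.castAdd n i) ^ N *
    (((s.mutate K k).mutate K i).x (Fin.castAdd n k) ^ N * hs₂.toricHom g) ∈ (s.mutate K i).torus K)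
    hN (by simp) (fun x y hx hy => ?_) fun e a he => ?_
  · rw [map_add, mul_add, mul_add]
    exact add_mem hx hy
  · obtain ⟨α, hα⟩ := hs₂.x_pow_mul_frame (Fin.castAdd n k) N e
    obtain ⟨β, hβ⟩ := hs₂.x_pow_mul_frame (Fin.castAdd n i) N
      (Pi.single (Fin.castAdd n k) (N : ℤ) + e)
    rw [hs₂.toricHom_mono, mul_smul_comm, mul_smul_comm, hα, mul_smul_comm, hβ]
    refine Subalgebra.smul_mem _ (Subalgebra.smul_mem _ (Subalgebra.smul_mem _
      (frame_mem fun j => ?_) _) _) _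
    have hej := he j
    by_cases hji : j = Fin.castAdd n i
    · subst hji
      obtain ⟨M, hM⟩ := Int.eq_ofNat_of_zero_le (a := (Pi.single (Fin.castAdd n i) (N : ℤ) +
          (Pi.single (Fin.castAdd n k) (N : ℤ) + e) : Fin (r + n) → ℤ) (Fin.castAdd n i)) (by
        simp only [Pi.add_apply, Pi.single_eq_same, Pi.single_eq_of_ne hικ]
        omega)
      rw [hM, zpow_natCast, ← hw]
      exact pow_mem ((mem_mutateComap hs i).1 hwE) M
    by_cases hjk : j = Fin.castAdd n k
    · subst hjk
      obtain ⟨M, hM⟩ := Int.eq_ofNat_of_zero_le (a := (Pi.single (Fin.castAdd n i) (N : ℤ) +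
          (Pi.single (Fin.castAdd n k) (N : ℤ) + e) : Fin (r + n) → ℤ) (Fin.castAdd n k)) (by
        simp only [Pi.add_apply, Pi.single_eq_same, Pi.single_eq_of_ne hji]
        omega)
      rw [hM, zpow_natCast, hxk]
      exact pow_mem ((mem_mutateComap hs i).1 hvE) M
    · rw [mutate_x_of_ne hji, mutate_x_of_ne hjk]
      exact x_zpow_mem_torus_mutate hs hinj h i fun hj => absurd hj hji

end Key

end QuantumSeed

/-! ### Classical clusters are algebraically independent -/

namespace Laurent

variable {K : Type*} [Field K] {m : ℕ} {L : Type*} [Field L] [Algebra K L]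

/-- The homomorphism `X^c ↦ ∏ yᵢ^{cᵢ}` from the Laurent polynomial ring to a field. -/
def evalHom (K : Type*) [Field K] [Algebra K L] (y : Fin m → L) (hy : ∀ i, y i ≠ 0) :
    Laurent K m →ₐ[K] L :=
  AddMonoidAlgebra.lift K L (Fin m → ℤ)
    { toFun := fun c => ∏ i, y i ^ (Multiplicative.toAdd c) i
      map_one' := by simp
      map_mul' := fun c d => by
        rw [← Finset.prod_mul_distrib]
        exact Finset.prod_congr rfl fun i _ => zpow_add₀ (hy i) _ _ }

theorem evalHom_single (y : Fin m → L) (hy : ∀ i, y i ≠ 0) (c : Fin m → ℤ) (a : K) :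
    evalHom K y hy (AddMonoidAlgebra.single c a) = a • ∏ i, y i ^ c i :=
  AddMonoidAlgebra.lift_single _ _ _

theorem evalHom_X (y : Fin m → L) (hy : ∀ i, y i ≠ 0) (i : Fin m) :
    evalHom K y hy (X K i) = y i := by
  rw [X, evalHom_single, one_smul, Finset.prod_eq_single i]
  · rw [Pi.single_eq_same, zpow_one]
  · intro j _ hj
    rw [Pi.single_eq_of_ne hj, zpow_zero]
  · simp

theorem X_pow (i : Fin m) (N : ℕ) :
    X K i ^ N = AddMonoidAlgebra.single (Pi.single i (N : ℤ)) 1 := by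
  rw [X, AddMonoidAlgebra.single_pow, one_pow, ← Pi.single_smul]
  simp

theorem prod_X_pow (c : Fin m → ℕ) :
    ∏ i, X K i ^ c i = AddMonoidAlgebra.single (fun i => (c i : ℤ)) 1 := by
  simp only [X_pow]
  have h : ∀ s : Finset (Fin m), ∏ i ∈ s, (AddMonoidAlgebra.single (Pi.single i (c i : ℤ)) 1 :
      Laurent K m) = AddMonoidAlgebra.single (∑ i ∈ s, Pi.single i (c i : ℤ)) 1 := by
    classical
    intro s
    induction s using Finset.induction_on with
    | empty => simp [AddMonoidAlgebra.one_def]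
    | insert a s ha ih =>
      rw [Finset.prod_insert ha, ih, AddMonoidAlgebra.single_mul_single, Finset.sum_insert ha,
        one_mul]
  rw [h, Finset.univ_sum_single]

theorem aeval_X_monomial (c : Fin m →₀ ℕ) (a : K) :
    MvPolynomial.aeval (X K) (MvPolynomial.monomial c a) =
      (AddMonoidAlgebra.single (fun i => (c i : ℤ)) a : Laurent K m) := by
  rw [MvPolynomial.aeval_monomial, Finsupp.prod_fintype _ _ (by simp), prod_X_pow,
    ← Algebra.smul_def, AddMonoidAlgebra.smul_single, smul_eq_mul, mul_one]

theorem algebraicIndependent_X : AlgebraicIndependent K (X K : Fin m → Laurent K m) := by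
  have h : ∀ P : MvPolynomial (Fin m) K, MvPolynomial.aeval (X K) P =
      (AddMonoidAlgebra.mapDomain (fun (c : Fin m →₀ ℕ) i => (c i : ℤ)) P : Laurent K m) := by
    intro P
    induction P using MvPolynomial.induction_on' with
    | monomial c a =>
      rw [aeval_X_monomial]
      change _ = AddMonoidAlgebra.mapDomain _ (AddMonoidAlgebra.single c a)
      rw [AddMonoidAlgebra.mapDomain_single]
    | add p q hp hq => rw [map_add, hp, hq, AddMonoidAlgebra.mapDomain_add]
  intro P Q hPQ
  change MvPolynomial.aeval (X K) P = MvPolynomial.aeval (X K) Q at hPQ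
  rw [h, h] at hPQ
  refine AddMonoidAlgebra.mapDomain_injective (fun c d hcd => ?_) hPQ
  ext i
  exact_mod_cast congrFun hcd i

theorem exists_aeval_eq (f : Laurent K m) : ∃ (N : ℕ) (P : MvPolynomial (Fin m) K),
    (∏ i, X K i) ^ N * f = MvPolynomial.aeval (X K) P := by
  induction f using AddMonoidAlgebra.induction_linear with
  | zero => exact ⟨0, 0, by simp⟩
  | add f g hf hg =>
    obtain ⟨N, P, hP⟩ := hf
    obtain ⟨M, Q, hQ⟩ := hg
    refine ⟨N + M, (∏ i, MvPolynomial.X i) ^ M * P + (∏ i, MvPolynomial.X i) ^ N * Q, ?_⟩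
    simp only [map_add, map_mul, map_pow, map_prod, MvPolynomial.aeval_X, ← hP, ← hQ]
    ring
  | single c a =>
    have hc : ∀ i, 0 ≤ ((∑ j, (c j).natAbs : ℕ) : ℤ) + c i := by
      intro i
      have := Finset.single_le_sum (f := fun j => (c j).natAbs) (fun _ _ => Nat.zero_le _)
        (Finset.mem_univ i)
      have h : (c i).natAbs ≤ ∑ j, (c j).natAbs := this
      omega
    -- The sum of the |c_j| is a single power that dominates every -c_i.
    refine ⟨∑ j, (c j).natAbs, MvPolynomial.monomial (Finsupp.equivFunOnFinite.symm
      fun i => (((∑ j, (c j).natAbs : ℕ) : ℤ) + c i).toNat) a, ?_⟩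
    rw [aeval_X_monomial, ← Finset.prod_pow, prod_X_pow, AddMonoidAlgebra.single_mul_single, one_mul]
    congr 1
    ext i
    simpa using hc i

theorem X_ne_zero (i : Fin m) : X K i ≠ 0 := by
  simp [X]

theorem evalHom_injective {y : Fin m → L} (hy : ∀ i, y i ≠ 0) (h : AlgebraicIndependent K y) :
    Function.Injective (evalHom K y hy) := by
  refine (injective_iff_map_eq_zero _).2 fun f hf => ?_
  obtain ⟨N, P, hP⟩ := exists_aeval_eq f
  have h1 : MvPolynomial.aeval y P = 0 := by
    have h2 : ((evalHom K y hy).comp (MvPolynomial.aeval (X K))) = MvPolynomial.aeval y := by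
      ext i
      simp [evalHom_X]
    rw [← h2, AlgHom.comp_apply, ← hP, map_mul, hf, mul_zero]
  rw [(injective_iff_map_eq_zero _).1 h P h1, map_zero] at hP
  exact (mul_eq_zero.1 hP).resolve_left
    (pow_ne_zero _ (Finset.prod_ne_zero_iff.2 fun i _ => X_ne_zero i))

end Laurent

section Field

variable {K : Type*} [Field K] {L : Type*} [Field L] [Algebra K L] {m : ℕ}

/-- The independent family `y` shows that the transcendence degree is at least m. A family of m
elements over which L is algebraic is then a transcendence basis. -/
theorem AlgebraicIndependent.of_adjoin_eq_top {y z : Fin m → L} (hy : AlgebraicIndependent K y)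
    (hz : IntermediateField.adjoin K (Set.range z) = ⊤) : AlgebraicIndependent K z := by
  have : Algebra.IsAlgebraic (Algebra.adjoin K (Set.range z)) L := by
    refine ⟨fun x => ?_⟩
    have hx : x ∈ IntermediateField.adjoin K (Set.range z) := hz ▸ IntermediateField.mem_top
    obtain ⟨a, ha, b, hb, rfl⟩ := IntermediateField.mem_adjoin_iff_div.1 hx
    rw [div_eq_mul_inv]
    exact (isAlgebraic_algebraMap (⟨a, ha⟩ : Algebra.adjoin K (Set.range z))).mul
      (isAlgebraic_algebraMap (⟨b, hb⟩ : Algebra.adjoin K (Set.range z))).inv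
  exact (Algebra.IsAlgebraic.isTranscendenceBasis_of_lift_le_trdeg_of_finite K z
    hy.lift_cardinalMk_le_trdeg).1

end Field

/-! ### Classical clusters generate the rational function field -/

namespace Seed

variable {K : Type*} [Field K] {r n : ℕ}

variable (K) in
/-- The cluster of `s` generates the ambient field. -/
def Generates {F : Type*} [Field F] [Algebra K F] (s : Seed F r n) : Prop :=
  IntermediateField.adjoin K (Set.range s.x) = ⊤

variable {s : Seed (RatField K (r + n)) r n}

theorem algebraicIndependent_initialSeed (B : Matrix (Fin (r + n)) (Fin r) ℤ) :
    AlgebraicIndependent K (initialSeed K B).x :=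
  Laurent.algebraicIndependent_X.map' (f := IsScalarTower.toAlgHom K (Laurent K (r + n))
    (RatField K (r + n))) (IsFractionRing.injective _ _)

theorem Generates.algebraicIndependent (hs : s.Generates K) : AlgebraicIndependent K s.x :=
  AlgebraicIndependent.of_adjoin_eq_top (algebraicIndependent_initialSeed (fun _ _ => 0)) hs

theorem Generates.ne_zero (hs : s.Generates K) (i : Fin (r + n)) : s.x i ≠ 0 :=
  hs.algebraicIndependent.ne_zero i

theorem generates_initialSeed (B : Matrix (Fin (r + n)) (Fin r) ℤ) :
    (initialSeed K B).Generates K := by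
  refine eq_top_iff.2 fun z _ => ?_
  have hx : ∀ i, algebraMap (Laurent K (r + n)) (RatField K (r + n)) (Laurent.X K i) ∈
      IntermediateField.adjoin K (Set.range (initialSeed K B).x) :=
    fun i => IntermediateField.subset_adjoin _ _ ⟨i, rfl⟩
  have h1 : ∀ f : Laurent K (r + n), algebraMap (Laurent K (r + n)) (RatField K (r + n)) f ∈
      IntermediateField.adjoin K (Set.range (initialSeed K B).x) := by
    intro f
    obtain ⟨N, P, hP⟩ := Laurent.exists_aeval_eq f
    have h2 : algebraMap (Laurent K (r + n)) (RatField K (r + n)) (∏ i, Laurent.X K i) ≠ 0 := by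
      refine (map_ne_zero_iff _ (IsFractionRing.injective _ _)).2 ?_
      exact Finset.prod_ne_zero_iff.2 fun i _ => Laurent.X_ne_zero i
    have h3 := congrArg (algebraMap (Laurent K (r + n)) (RatField K (r + n))) hP
    rw [map_mul, map_pow, mul_comm, ← eq_mul_inv_iff_mul_eq₀ (pow_ne_zero N h2)] at h3
    rw [h3]
    refine mul_mem ?_ (inv_mem (pow_mem ?_ N))
    · clear hP h3
      induction P using MvPolynomial.induction_on with
      | C a =>
        rw [MvPolynomial.aeval_C, ← IsScalarTower.algebraMap_apply]
        exact IntermediateField.algebraMap_mem _ a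
      | add p q hp hq =>
        rw [map_add, map_add]
        exact add_mem hp hq
      | mul_X p i hp =>
        rw [map_mul, map_mul, MvPolynomial.aeval_X]
        exact mul_mem hp (hx i)
    · rw [map_prod]
      exact prod_mem fun i _ => hx i
  obtain ⟨a, b, hb, rfl⟩ := IsFractionRing.div_surjective (A := Laurent K (r + n)) z
  exact div_mem (h1 a) (h1 b)

/-- For c = d the sum is twice a monomial, and the characteristic matters. -/
theorem Generates.exchange_ne_zero [CharZero K] (hs : s.Generates K) (c d : Fin (r + n) → ℤ) :
    ∏ i, s.x i ^ c i + ∏ i, s.x i ^ d i ≠ 0 := by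
  classical
  have h := Laurent.evalHom_injective (K := K) hs.ne_zero hs.algebraicIndependent
  have h1 : Laurent.evalHom K s.x hs.ne_zero (AddMonoidAlgebra.single c 1 +
      AddMonoidAlgebra.single d 1) = ∏ i, s.x i ^ c i + ∏ i, s.x i ^ d i := by
    rw [map_add, Laurent.evalHom_single, Laurent.evalHom_single, one_smul, one_smul]
  rw [← h1]
  refine (map_ne_zero_iff _ h).2 fun h2 => ?_
  have h3 := congrArg (fun f : Laurent K (r + n) => f.coeff c) h2
  simp only [AddMonoidAlgebra.coeff_add, AddMonoidAlgebra.coeff_single, AddMonoidAlgebra.coeff_zero,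
    Finsupp.add_apply, Finsupp.single_apply, Finsupp.zero_apply, if_true] at h3
  split_ifs at h3
  · norm_num at h3
  · norm_num at h3

theorem mutate_x_of_ne {F : Type*} [Field F] {s : Seed F r n} {k : Fin r} {i : Fin (r + n)}
    (hi : i ≠ Fin.castAdd n k) : (s.mutate k).x i = s.x i :=
  Function.update_of_ne hi _ _

theorem mutate_x_self {F : Type*} [Field F] {s : Seed F r n} (k : Fin r) :
    (s.mutate k).x (Fin.castAdd n k) = (∏ i, s.x i ^ max (s.B i k) 0 +
      ∏ i, s.x i ^ max (-s.B i k) 0) / s.x (Fin.castAdd n k) :=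
  Function.update_self _ _ _

/-- As b_kk = 0, the exchange polynomial does not involve x_k, so x_k is recovered by dividing it by
the new variable. -/
theorem Generates.mutate [CharZero K] (hs : s.Generates K) {k : Fin r}
    (hk : s.B (Fin.castAdd n k) k = 0) : (s.mutate k).Generates K := by
  refine eq_top_iff.2 ((eq_top_iff.1 hs).trans (IntermediateField.adjoin_le_iff.2 ?_))
  have hx : ∀ i, (s.mutate k).x i ∈ IntermediateField.adjoin K (Set.range (s.mutate k).x) :=
    fun i => IntermediateField.subset_adjoin _ _ ⟨i, rfl⟩
  have hne : ∀ i, i ≠ Fin.castAdd n k →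
      s.x i ∈ IntermediateField.adjoin K (Set.range (s.mutate k).x) := by
    intro i hi
    rw [← mutate_x_of_ne hi]
    exact hx i
  have hprod : ∀ c : Fin (r + n) → ℤ, c (Fin.castAdd n k) = 0 →
      ∏ i, s.x i ^ c i ∈ IntermediateField.adjoin K (Set.range (s.mutate k).x) := by
    intro c hc
    refine prod_mem fun i _ => ?_
    by_cases hi : i = Fin.castAdd n k
    · rw [hi, hc, zpow_zero]
      exact one_mem _
    · exact zpow_mem (hne i hi) _
  rintro _ ⟨i, rfl⟩
  by_cases hi : i = Fin.castAdd n k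
  · subst hi
    have h1 := mutate_x_self (s := s) k
    have h2 : s.x (Fin.castAdd n k) = (∏ i, s.x i ^ max (s.B i k) 0 +
        ∏ i, s.x i ^ max (-s.B i k) 0) / (s.mutate k).x (Fin.castAdd n k) := by
      rw [h1, div_div_cancel₀ (hs.exchange_ne_zero _ _)]
    rw [h2]
    exact div_mem (add_mem (hprod _ (by simp [hk])) (hprod _ (by simp [hk]))) (hx _)
  · exact hne i hi

end Seed

/-! ### Specialization at `q = 1` -/

section EvalOne

variable {K : Type*} [Field K]

/-- The evaluation of `R` at `q^{1/2} = 1`. -/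
def evalOne (K : Type*) [Field K] : QRing K →+* K := LaurentPolynomial.eval₂ (RingHom.id K) 1

theorem evalOne_qHalf (a : ℤ) : evalOne K (qHalf K a) = 1 := by
  simp [evalOne, qHalf]

theorem evalOne_algebraMap (a : K) : evalOne K (algebraMap K (QRing K) a) = a := by
  exact LaurentPolynomial.eval₂_C (RingHom.id K) 1 a

theorem exists_qHalf_mul_eq_toLaurent (a : QRing K) : ∃ (n : ℤ) (f : Polynomial K),
    a = qHalf K n * Polynomial.toLaurent f := by
  obtain ⟨n, f, hf⟩ := a.exists_T_pow
  refine ⟨-n, f, ?_⟩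
  rw [hf, qHalf, mul_comm, mul_assoc, ← LaurentPolynomial.T_add, add_neg_cancel,
    LaurentPolynomial.T_zero, mul_one]

theorem toLaurent_X_sub_one :
    Polynomial.toLaurent (Polynomial.X - Polynomial.C 1 : Polynomial K) = qHalf K 1 - 1 := by
  simp [qHalf]

theorem evalOne_toLaurent (f : Polynomial K) : evalOne K (Polynomial.toLaurent f) = f.eval 1 := by
  rw [evalOne, LaurentPolynomial.eval₂_toLaurent, Units.val_one, Polynomial.eval]

theorem evalOne_eq_zero_iff {a : QRing K} : evalOne K a = 0 ↔ qHalf K 1 - 1 ∣ a := by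
  constructor
  · intro h
    obtain ⟨n, f, rfl⟩ := exists_qHalf_mul_eq_toLaurent a
    rw [map_mul, evalOne_qHalf, one_mul, evalOne_toLaurent] at h
    obtain ⟨g, rfl⟩ := Polynomial.dvd_iff_isRoot.2 h
    rw [map_mul, toLaurent_X_sub_one]
    exact Dvd.intro (qHalf K n * Polynomial.toLaurent g) (by ring)
  · rintro ⟨b, rfl⟩
    rw [map_mul, map_sub, evalOne_qHalf, map_one, sub_self, zero_mul]

/-- R is a Noetherian domain in which p is not a unit. -/
theorem exists_not_pow_dvd {a : QRing K} (ha : a ≠ 0) : ∃ N : ℕ, ¬ (qHalf K 1 - 1) ^ N ∣ a := by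
  have : IsNoetherianRing (QRing K) :=
    IsLocalization.isNoetherianRing (Submonoid.powers (Polynomial.X : Polynomial K)) _ inferInstance
  have h : ¬ IsUnit (qHalf K 1 - 1) := by
    intro h
    have := h.map (evalOne K)
    rw [map_sub, evalOne_qHalf, map_one, sub_self] at this
    exact not_isUnit_zero this
  obtain ⟨N, hN⟩ := FiniteMultiplicity.of_not_isUnit h ha
  exact ⟨N + 1, hN⟩

theorem qHalf_one_sub_one_ne_zero : qHalf K 1 - 1 ≠ 0 := by
  intro h
  obtain ⟨N, hN⟩ := exists_not_pow_dvd (one_ne_zero (α := QRing K))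
  rw [← toLaurent_X_sub_one, map_eq_zero_iff _ Polynomial.toLaurent_injective] at h
  exact Polynomial.X_sub_C_ne_zero 1 h

end EvalOne

/-! ### Localization of the quantum torus at q = 1 -/

namespace QuantumTorus

variable {K : Type*} [Field K] {m : ℕ} {Λ : Matrix (Fin m) (Fin m) ℤ}

variable (K Λ) in
/-- The specialization of the based quantum torus at `q^{1/2} = 1`. -/
def specialize : QuantumTorus K Λ →+* Laurent K m :=
  lift ((algebraMap K (Laurent K m)).comp (evalOne K)) (fun _ _ => mul_comm _ _)
    (fun c => AddMonoidAlgebra.single c 1) rfl fun c d => by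
      rw [RingHom.comp_apply, evalOne_qHalf, map_one, one_mul, AddMonoidAlgebra.single_mul_single,
        one_mul]

theorem specialize_mono (e : Fin m → ℤ) (a : QRing K) :
    specialize K Λ (mono Λ e a) = AddMonoidAlgebra.single e (evalOne K a) := by
  refine (lift_mono _ _ _ _ _ e a).trans ?_
  rw [RingHom.comp_apply, ← Algebra.smul_def, AddMonoidAlgebra.smul_single, smul_eq_mul, mul_one]

theorem specialize_X (e : Fin m → ℤ) :
    specialize K Λ (X K Λ e) = AddMonoidAlgebra.single e 1 := by
  rw [X, specialize_mono, map_one]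

theorem specialize_smul (a : QRing K) (x : QuantumTorus K Λ) :
    specialize K Λ (a • x) = evalOne K a • specialize K Λ x := by
  induction x using induct with
  | h0 => simp only [smul_zero, map_zero]
  | ha x y hx hy => simp only [smul_add, map_add, hx, hy]
  | h1 e b =>
    rw [smul_mono, specialize_mono, specialize_mono, map_mul, AddMonoidAlgebra.smul_single,
      smul_eq_mul]

theorem coeff_specialize (x : QuantumTorus K Λ) (e : Fin m → ℤ) :
    (specialize K Λ x).coeff e = evalOne K (x.coeff e) := by
  classical
  induction x using induct with
  | h0 => simp [coeff_zero]
  | ha x y hx hy =>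
    rw [map_add, coeff_add, map_add, ← hx, ← hy]
    rfl
  | h1 f b =>
    rw [specialize_mono, coeff_mono, AddMonoidAlgebra.coeff_single, Finsupp.single_apply]
    split_ifs <;> simp

theorem exists_eq_smul_of_specialize_eq_zero {x : QuantumTorus K Λ} (hx : specialize K Λ x = 0) :
    ∃ y, x = (qHalf K 1 - 1) • y := by
  have h : ∀ e, ∃ b, x.coeff e = (qHalf K 1 - 1) * b := fun e =>
    evalOne_eq_zero_iff.1 (by rw [← coeff_specialize, hx]; rfl)
  choose b hb using h
  have h : x = ∑ e ∈ (show (Fin m → ℤ) →₀ QRing K from x).support, mono Λ e (x.coeff e) :=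
    (Finsupp.sum_single (show (Fin m → ℤ) →₀ QRing K from x)).symm
  refine ⟨∑ e ∈ (show (Fin m → ℤ) →₀ QRing K from x).support, mono Λ e (b e), ?_⟩
  rw [Finset.smul_sum]
  refine h.trans (Finset.sum_congr rfl fun e _ => ?_)
  rw [smul_mono, ← hb]

theorem smul_left_cancel {a : QRing K} (ha : a ≠ 0) {x y : QuantumTorus K Λ} (h : a • x = a • y) :
    x = y :=
  coeff_ext fun e => mul_left_cancel₀ ha (congrArg (fun z => coeff z e) h)

/-- Division by p continues as long as the specialization vanishes, and must stop because a nonzero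
coefficient is divisible by only finitely many powers of p. -/
theorem exists_eq_pow_smul {x : QuantumTorus K Λ} (hx : x ≠ 0) :
    ∃ (N : ℕ) (y : QuantumTorus K Λ), x = (qHalf K 1 - 1) ^ N • y ∧ specialize K Λ y ≠ 0 := by
  by_contra! h
  have h1 : ∀ N : ℕ, ∃ y, x = (qHalf K 1 - 1) ^ N • y := by
    intro N
    induction N with
    | zero => exact ⟨x, by rw [pow_zero, one_smul]⟩
    | succ N ih =>
      obtain ⟨y, hy⟩ := ih
      obtain ⟨z, rfl⟩ := exists_eq_smul_of_specialize_eq_zero (h N y hy)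
      exact ⟨z, by rw [hy, smul_smul, pow_succ]⟩
  apply hx
  refine coeff_ext fun e => ?_
  by_contra h2
  obtain ⟨N, hN⟩ := exists_not_pow_dvd h2
  obtain ⟨y, rfl⟩ := h1 N
  exact hN ⟨y.coeff e, coeff_smul _ _ _⟩

variable (K Λ) in
/-- The elements of the based quantum torus with nonzero specialization. -/
def denominators : Submonoid (QuantumTorus K Λ) := (Laurent K m)⁰.comap (specialize K Λ)

theorem mem_denominators {x : QuantumTorus K Λ} : x ∈ denominators K Λ ↔ specialize K Λ x ≠ 0 :=
  mem_nonZeroDivisors_iff_ne_zero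

/-- In the Ore relation b r = a s of the full torus, write b = p^N c with c a denominator. If N > 0,
the specialization of a s vanishes. As that of s does not, p divides a and can be cancelled. After N
steps the relation has c in place of b. -/
instance : OreLocalization.OreSet (denominators K Λ) :=
  Classical.choice <| OreLocalization.nonempty_oreSet_iff_of_noZeroDivisors.2 fun r s => by
    have hs := mem_denominators.1 s.2
    have hs0 : s.1 ≠ 0 := by
      rintro h
      rw [h, map_zero] at hs
      exact hs rfl
    obtain ⟨a, b, hb, h⟩ : ∃ a b : QuantumTorus K Λ, b ≠ 0 ∧ b * r = a * s :=
      ore_condition (Λ := Λ) r s.1 hs0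
    obtain ⟨N, c, rfl, hc⟩ := exists_eq_pow_smul hb
    clear hb
    induction N generalizing a with
    | zero =>
      rw [pow_zero, one_smul] at h
      exact ⟨a, ⟨c, mem_denominators.2 hc⟩, h⟩
    | succ N ih =>
      have h1 := congrArg (specialize K Λ) h
      rw [map_mul, map_mul, specialize_smul, map_pow, map_sub, evalOne_qHalf, map_one, sub_self,
        zero_pow (Nat.succ_ne_zero N), zero_smul, zero_mul] at h1
      obtain ⟨a', rfl⟩ := exists_eq_smul_of_specialize_eq_zero
        ((mul_eq_zero.1 h1.symm).resolve_right hs)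
      refine ih a' (smul_left_cancel qHalf_one_sub_one_ne_zero ?_)
      rw [← smul_mul_assoc, ← smul_mul_assoc, smul_smul, ← pow_succ', h]

variable (K Λ) in
/-- The localization of the based quantum torus at `q^{1/2} = 1`. -/
abbrev LocalTorus : Type _ := OreLocalization (denominators K Λ) (QuantumTorus K Λ)

variable (K Λ) in
/-- The specialization `X^c ↦ X^c`, with values in the field of fractions. -/
def specializeFrac : QuantumTorus K Λ →+* RatField K m :=
  (algebraMap (Laurent K m) (RatField K m)).comp (specialize K Λ)

theorem specializeFrac_ne_zero {x : QuantumTorus K Λ} (hx : specialize K Λ x ≠ 0) :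
    specializeFrac K Λ x ≠ 0 :=
  (map_ne_zero_iff _ (IsFractionRing.injective (Laurent K m) (RatField K m))).2 hx

theorem numerator_ne_zero {x : QuantumTorus K Λ} (hx : x ≠ 0) :
    OreLocalization.numeratorRingHom (S := (QuantumTorus K Λ)⁰) x ≠ 0 := by
  have h := OreLocalization.numeratorHom_inj (S := (QuantumTorus K Λ)⁰)
    (fun x hx => (mem_nonZeroDivisors_iff.1 hx).1)
  intro h0
  exact hx (h (h0.trans (map_zero (OreLocalization.numeratorRingHom (S := (QuantumTorus K Λ)⁰))).symm))

theorem ne_zero_of_specialize {x : QuantumTorus K Λ} (hx : specialize K Λ x ≠ 0) : x ≠ 0 := by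
  rintro rfl
  exact hx (map_zero _)

variable (K Λ) in
/-- The specialization of the local torus. -/
def localSpecialize : LocalTorus K Λ →+* RatField K m :=
  OreLocalization.universalHom (specializeFrac K Λ)
    (IsUnit.liftRight ((specializeFrac K Λ).toMonoidHom.comp (denominators K Λ).subtype)
      fun x => (specializeFrac_ne_zero (mem_denominators.1 x.2)).isUnit) fun _ => rfl

variable (K Λ) in
/-- The inclusion of the local torus in the skew field of fractions. -/
def localIncl : LocalTorus K Λ →+* QuantumField K Λ :=
  OreLocalization.universalHom (OreLocalization.numeratorRingHom (S := (QuantumTorus K Λ)⁰))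
    (IsUnit.liftRight (OreLocalization.numeratorRingHom.toMonoidHom.comp (denominators K Λ).subtype)
      fun x => (numerator_ne_zero (ne_zero_of_specialize (mem_denominators.1 x.2))).isUnit)
    fun _ => rfl

theorem localSpecialize_oreDiv (a : QuantumTorus K Λ) (b : denominators K Λ) :
    localSpecialize K Λ (a /ₒ b) = (specializeFrac K Λ b)⁻¹ * specializeFrac K Λ a := by
  refine (OreLocalization.universalHom_apply ..).trans ?_
  rw [Units.val_inv_eq_inv_val]
  rfl

theorem localIncl_oreDiv (a : QuantumTorus K Λ) (b : denominators K Λ) :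
    localIncl K Λ (a /ₒ b) = (OreLocalization.numeratorRingHom (S := (QuantumTorus K Λ)⁰) b.1)⁻¹ *
      OreLocalization.numeratorRingHom a := by
  refine (OreLocalization.universalHom_apply ..).trans ?_
  rw [Units.val_inv_eq_inv_val]
  rfl

theorem localIncl_injective : Function.Injective (localIncl K Λ) := by
  refine (injective_iff_map_eq_zero _).2 fun w hw => ?_
  induction w using OreLocalization.ind with
  | _ a b =>
    rw [localIncl_oreDiv] at hw
    have ha : a = 0 := by
      by_contra h
      exact mul_ne_zero (inv_ne_zero (numerator_ne_zero
        (ne_zero_of_specialize (mem_denominators.1 b.2)))) (numerator_ne_zero h) hw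
    rw [ha, OreLocalization.zero_oreDiv]

end QuantumTorus

/-- `x ∈ F` is regular at `q^{1/2} = 1`, with value `y`. -/
def SpecializesTo {K : Type*} [Field K] {m : ℕ} {Λ : Matrix (Fin m) (Fin m) ℤ}
    (x : QuantumField K Λ) (y : RatField K m) : Prop :=
  ∃ w, localIncl K Λ w = x ∧ localSpecialize K Λ w = y

namespace SpecializesTo

variable {K : Type*} [Field K] {m : ℕ} {Λ : Matrix (Fin m) (Fin m) ℤ} {x x' : QuantumField K Λ}
  {y y' : RatField K m}

theorem unique (h : SpecializesTo x y) (h' : SpecializesTo x y') : y = y' := by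
  obtain ⟨w, rfl, rfl⟩ := h
  obtain ⟨w', hw', rfl⟩ := h'
  rw [localIncl_injective hw']

theorem add (h : SpecializesTo x y) (h' : SpecializesTo x' y') : SpecializesTo (x + x') (y + y') := by
  obtain ⟨w, rfl, rfl⟩ := h
  obtain ⟨w', rfl, rfl⟩ := h'
  exact ⟨w + w', map_add _ _ _, map_add _ _ _⟩

theorem mul (h : SpecializesTo x y) (h' : SpecializesTo x' y') : SpecializesTo (x * x') (y * y') := by
  obtain ⟨w, rfl, rfl⟩ := h
  obtain ⟨w', rfl, rfl⟩ := h'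
  exact ⟨w * w', map_mul _ _ _, map_mul _ _ _⟩

theorem one : SpecializesTo (1 : QuantumField K Λ) 1 := ⟨1, map_one _, map_one _⟩

theorem zero : SpecializesTo (0 : QuantumField K Λ) 0 := ⟨0, map_zero _, map_zero _⟩

theorem numerator (f : QuantumTorus K Λ) :
    SpecializesTo (OreLocalization.numeratorRingHom (S := (QuantumTorus K Λ)⁰) f)
      (algebraMap (Laurent K m) (RatField K m) (specialize K Λ f)) := by
  refine ⟨f /ₒ 1, ?_, ?_⟩
  · rw [localIncl_oreDiv, OneMemClass.coe_one, map_one, inv_one, one_mul]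
  · rw [localSpecialize_oreDiv, OneMemClass.coe_one, map_one, inv_one, one_mul]
    rfl

theorem of_algebraMap (a : QRing K) :
    SpecializesTo (algebraMap (QRing K) (QuantumField K Λ) a)
      (algebraMap K (RatField K m) (evalOne K a)) := by
  have h := numerator (algebraMap (QRing K) (QuantumTorus K Λ) a)
  have h1 : specialize K Λ (algebraMap (QRing K) (QuantumTorus K Λ) a) =
      algebraMap K (Laurent K m) (evalOne K a) := by
    rw [Algebra.algebraMap_eq_smul_one, specialize_smul, map_one, Algebra.algebraMap_eq_smul_one]
  rw [h1, ← IsScalarTower.algebraMap_apply] at h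
  exact h

theorem smul (h : SpecializesTo x y) (a : QRing K) :
    SpecializesTo (a • x) (evalOne K a • y) := by
  rw [Algebra.smul_def, Algebra.smul_def]
  exact (of_algebraMap a).mul h

theorem qHalf_smul (h : SpecializesTo x y) (a : ℤ) : SpecializesTo (qHalf K a • x) y := by
  have := h.smul (qHalf K a)
  rwa [evalOne_qHalf, one_smul] at this

/-- A nonzero value means that the numerator has nonzero specialization, so it may serve as a
denominator. -/
theorem inv (h : SpecializesTo x y) (hy : y ≠ 0) : SpecializesTo x⁻¹ y⁻¹ := by
  obtain ⟨w, rfl, rfl⟩ := h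
  induction w using OreLocalization.ind with
  | _ a b =>
    have ha : specialize K Λ a ≠ 0 := by
      intro h
      rw [localSpecialize_oreDiv, specializeFrac, RingHom.comp_apply, RingHom.comp_apply, h,
        map_zero, mul_zero] at hy
      exact hy rfl
    refine ⟨b.1 /ₒ ⟨a, mem_denominators.2 ha⟩, ?_, ?_⟩
    · rw [localIncl_oreDiv, localIncl_oreDiv, mul_inv_rev, inv_inv]
    · rw [localSpecialize_oreDiv, localSpecialize_oreDiv, mul_inv_rev, inv_inv]

theorem pow (h : SpecializesTo x y) (n : ℕ) : SpecializesTo (x ^ n) (y ^ n) := by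
  obtain ⟨w, rfl, rfl⟩ := h
  exact ⟨w ^ n, map_pow _ _ _, map_pow _ _ _⟩

theorem zpow (h : SpecializesTo x y) (hy : y ≠ 0) (n : ℤ) : SpecializesTo (x ^ n) (y ^ n) := by
  obtain ⟨n, rfl | rfl⟩ := n.eq_nat_or_neg
  · simpa using h.pow n
  · rw [zpow_neg, zpow_neg, zpow_natCast, zpow_natCast]
    exact (h.pow n).inv (pow_ne_zero n hy)

theorem ordMon {l : ℕ} {x : Fin l → QuantumField K Λ} {y : Fin l → RatField K m}
    (h : ∀ i, SpecializesTo (x i) (y i)) (hy : ∀ i, y i ≠ 0) (c : Fin l → ℤ) :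
    SpecializesTo (ordMon x c) (∏ i, y i ^ c i) := by
  induction l with
  | zero => simpa [QCA.ordMon] using one
  | succ l ih =>
    rw [ordMon_succ, Fin.prod_univ_succ]
    exact ((h 0).zpow (hy 0) _).mul (ih (fun i => h _) (fun i => hy _) _)

end SpecializesTo

section ScalarTorsion

variable {K : Type*} [Field K] {m : ℕ} {Λ : Matrix (Fin m) (Fin m) ℤ}

theorem smul_eq_zero_quantumField {a : QRing K} (ha : a ≠ 0) {x : QuantumField K Λ}
    (h : a • x = 0) : x = 0 := by
  rw [Algebra.smul_def] at h
  refine (mul_eq_zero.1 h).resolve_left ?_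
  refine numerator_ne_zero fun h0 => ?_
  rw [Algebra.algebraMap_eq_smul_one] at h0
  exact one_ne_zero (smul_left_cancel ha (h0.trans (smul_zero a).symm))

end ScalarTorsion

/-! ### Quantum seeds and their classical limits -/

/-- The quantum seed `s` is toric and compatible, and `t` is its classical limit. -/
structure IsLimitSeed {K : Type*} [Field K] {r n : ℕ} {Λ : Matrix (Fin (r + n)) (Fin (r + n)) ℤ}
    (s : QuantumSeed (QuantumField K Λ) r n) (t : Seed (RatField K (r + n)) r n) : Prop where
  toric : s.IsToric K
  compatible : IsCompatiblePair s.Λ s.B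
  B_eq : s.B = t.B
  specializesTo : ∀ i, SpecializesTo (s.x i) (t.x i)
  generates : t.Generates K

namespace IsLimitSeed

variable {K : Type*} [Field K] {r n : ℕ} {Λ : Matrix (Fin (r + n)) (Fin (r + n)) ℤ}
  {s : QuantumSeed (QuantumField K Λ) r n} {t : Seed (RatField K (r + n)) r n}

theorem frame (h : IsLimitSeed s t) (c : Fin (r + n) → ℤ) :
    SpecializesTo (s.frame K c) (∏ i, t.x i ^ c i) := by
  rw [QuantumSeed.frame_eq]
  exact (SpecializesTo.ordMon h.specializesTo h.generates.ne_zero c).qHalf_smul _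

theorem toricHom (h : IsLimitSeed s t) (f : QuantumTorus K s.Λ) :
    SpecializesTo (h.toric.toricHom f)
      (Laurent.evalHom K t.x h.generates.ne_zero (specialize K s.Λ f)) := by
  induction f using induct with
  | h0 =>
    simp only [map_zero]
    exact SpecializesTo.zero
  | ha x y hx hy =>
    simp only [map_add]
    exact hx.add hy
  | h1 e a =>
    rw [h.toric.toricHom_mono, specialize_mono, Laurent.evalHom_single]
    exact (h.frame e).smul a

theorem specialize_eq_zero (h : IsLimitSeed s t) {f : QuantumTorus K s.Λ}
    (hf : SpecializesTo (h.toric.toricHom f) 0) : specialize K s.Λ f = 0 := by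
  refine Laurent.evalHom_injective h.generates.ne_zero h.generates.algebraicIndependent ?_
  rw [map_zero]
  exact (h.toricHom f).unique hf

/-- A nonzero element is p^N g with g nonzero at q = 1. The skew field has no R-torsion, so g would
map to 0, contradicting the algebraic independence of the limit cluster. -/
theorem toricHom_injective (h : IsLimitSeed s t) : Function.Injective h.toric.toricHom := by
  refine (injective_iff_map_eq_zero _).2 fun f hf => ?_
  by_contra hne
  obtain ⟨N, g, rfl, hg⟩ := exists_eq_pow_smul hne
  apply hg
  apply h.specialize_eq_zero
  rw [map_smul] at hf
  rw [smul_eq_zero_quantumField (pow_ne_zero N qHalf_one_sub_one_ne_zero) hf]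
  exact SpecializesTo.zero

/-- Since x is regular at q = 1, the value of p x is 0. By algebraic independence of the limit
cluster, the element of the based torus representing p x is divisible by p. -/
theorem mem_torus_of_smul_mem (h : IsLimitSeed s t) {x : QuantumField K Λ} {y : RatField K (r + n)}
    (hx : SpecializesTo x y) (hxs : (qHalf K 1 - 1) • x ∈ s.torus K) : x ∈ s.torus K := by
  obtain ⟨g, hg⟩ := h.toric.mem_torus_iff.1 hxs
  have h1 : specialize K s.Λ g = 0 := by
    apply h.specialize_eq_zero
    rw [hg]
    have := hx.smul (qHalf K 1 - 1)
    rwa [map_sub, evalOne_qHalf, map_one, sub_self, zero_smul] at this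
  obtain ⟨g, rfl⟩ := exists_eq_smul_of_specialize_eq_zero h1
  rw [map_smul, ← sub_eq_zero, ← smul_sub] at hg
  rw [← sub_eq_zero.1 (smul_eq_zero_quantumField qHalf_one_sub_one_ne_zero hg)]
  exact h.toric.toricHom_mem_torus g

theorem prod_exchangeExponent (ht : ∀ i, t.x i ≠ 0) (b : Fin (r + n) → ℤ) (k : Fin r) :
    ∏ i, t.x i ^ exchangeExponent b k i =
      (∏ i, t.x i ^ max (b i) 0) / t.x (Fin.castAdd n k) := by
  simp only [exchangeExponent, zpow_add₀ (ht _), Finset.prod_mul_distrib]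
  rw [div_eq_inv_mul]
  congr 1
  rw [Finset.prod_eq_single (Fin.castAdd n k)]
  · rw [if_pos rfl, zpow_neg_one]
  · intro i _ hi
    rw [if_neg hi, zpow_zero]
  · simp

theorem mutate [CharZero K] (h : IsLimitSeed s t) (k : Fin r) :
    IsLimitSeed (s.mutate K k) (t.mutate k) where
  toric := h.toric.mutate h.toricHom_injective h.compatible k
  compatible := h.compatible.mutate k
  B_eq := by
    change mutateMatrix s.B k = mutateMatrix t.B k
    rw [h.B_eq]
  specializesTo i := by
    by_cases hi : i = Fin.castAdd n k
    · subst hi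
      rw [QuantumSeed.mutate_x_self, Seed.mutate_x_self, add_div]
      have h1 := (h.frame (exchangeExponent (col s.B k) k)).add
        (h.frame (exchangeExponent (-col s.B k) k))
      rw [prod_exchangeExponent h.generates.ne_zero, prod_exchangeExponent h.generates.ne_zero] at h1
      rw [← h.B_eq]
      exact h1
    · rw [QuantumSeed.mutate_x_of_ne hi, Seed.mutate_x_of_ne hi]
      exact h.specializesTo i
  generates := h.generates.mutate (h.B_eq ▸ h.compatible.diag k)

theorem mutate_mutate (h : IsLimitSeed s t) (k : Fin r) : (s.mutate K k).mutate K k = s :=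
  h.toric.mutate_mutate h.toricHom_injective h.compatible k

theorem mem_upper {s : QuantumSeed (QuantumField K Λ) r n} {z : QuantumField K Λ} :
    z ∈ s.upper K ↔ z ∈ s.torus K ∧ ∀ k, z ∈ (s.mutate K k).torus K := by
  rw [QuantumSeed.upper, Algebra.mem_inf, Algebra.mem_iInf]

theorem upper_le_upper_mutate [CharZero K] (h : IsLimitSeed s t) (k : Fin r) :
    s.upper K ≤ (s.mutate K k).upper K := by
  intro z hz
  rw [mem_upper] at hz ⊢
  refine ⟨hz.2 k, fun i => ?_⟩
  by_cases hki : k = i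
  · subst hki
    rw [h.mutate_mutate]
    exact hz.1
  · have h₁ := h.mutate k
    -- The inclusion is used with base seed μ_k s. As μ_k μ_k s = s, it reads T(μ_k s) ∩ T(μ_i s) ⊆
    -- T(μ_i μ_k s).
    refine QuantumSeed.torus_inf_torus_mutate_mutate_le h₁.toric h₁.toricHom_injective h₁.compatible
      hki (h₁.mutate k).toricHom_injective ⟨hz.2 k, ?_⟩
    rw [h.mutate_mutate]
    exact hz.2 i

theorem upper_mutate [CharZero K] (h : IsLimitSeed s t) (k : Fin r) :
    (s.mutate K k).upper K = s.upper K := by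
  refine le_antisymm ?_ (h.upper_le_upper_mutate k)
  have := (h.mutate k).upper_le_upper_mutate k
  rwa [h.mutate_mutate] at this

theorem x_mem_upper (h : IsLimitSeed s t) (i : Fin (r + n)) : s.x i ∈ s.upper K :=
  mem_upper.2 ⟨QuantumSeed.x_mem_torus i,
    fun k => QuantumSeed.x_mem_torus_mutate h.toric h.toricHom_injective h.compatible k i⟩

theorem exists_of_mutationEquiv [CharZero K] (h : IsLimitSeed s t)
    {s' : QuantumSeed (QuantumField K Λ) r n} (hs' : QuantumSeed.MutationEquiv K s s') :
    s'.upper K = s.upper K ∧ ∃ t', IsLimitSeed s' t' := by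
  unfold QuantumSeed.MutationEquiv at hs'
  induction hs' with
  | refl => exact ⟨rfl, t, h⟩
  | tail _ hk ih =>
    obtain ⟨k, rfl⟩ := hk
    obtain ⟨h1, t', h'⟩ := ih
    exact ⟨(h'.upper_mutate k).trans h1, _, h'.mutate k⟩

/-- The same mutation sequence on the quantum side lifts a classical seed, so every classical seed
is the limit of a quantum seed with unchanged upper algebra. -/
theorem exists_of_seed_mutationEquiv [CharZero K] (h : IsLimitSeed s t)
    {t' : Seed (RatField K (r + n)) r n} (ht' : Seed.MutationEquiv t t') :
    ∃ s', s'.upper K = s.upper K ∧ IsLimitSeed s' t' := by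
  unfold Seed.MutationEquiv at ht'
  induction ht' with
  | refl => exact ⟨s, rfl, h⟩
  | tail _ hk ih =>
    obtain ⟨k, rfl⟩ := hk
    obtain ⟨s', h1, h'⟩ := ih
    exact ⟨s'.mutate K k, (h'.upper_mutate k).trans h1, h'.mutate k⟩

theorem upper_eq_iInf [CharZero K] (h : IsLimitSeed s t) : s.upper K =
    ⨅ (s' : QuantumSeed (QuantumField K Λ) r n) (_ : QuantumSeed.MutationEquiv K s s'),
      s'.torus K := by
  refine le_antisymm (le_iInf₂ fun s' hs' => ?_) (le_inf (iInf₂_le s Relation.ReflTransGen.refl)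
    (le_iInf fun k => iInf₂_le _ (Relation.ReflTransGen.single ⟨k, rfl⟩)))
  rw [← (h.exists_of_mutationEquiv hs').1]
  exact inf_le_left

/-- The value of a frame expansion is the Laurent polynomial with specialized coefficients in the
limit cluster. -/
theorem specializesTo_mem_torus (h : IsLimitSeed s t) {x : QuantumField K Λ}
    {y : RatField K (r + n)} (hxy : SpecializesTo x y) (hx : x ∈ s.torus K) : y ∈ t.torus K := by
  have hzpow : ∀ i (a : ℤ), t.x i ^ a ∈ t.torus K := by
    intro i a
    have h1 : t.x i ∈ t.torus K := Algebra.subset_adjoin (Or.inl ⟨i, rfl⟩)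
    have h2 : (t.x i)⁻¹ ∈ t.torus K := Algebra.subset_adjoin (Or.inr ⟨i, rfl⟩)
    obtain ⟨a, rfl | rfl⟩ := a.eq_nat_or_neg
    · rw [zpow_natCast]
      exact pow_mem h1 a
    · rw [zpow_neg, zpow_natCast, ← inv_pow]
      exact pow_mem h2 a
  obtain ⟨f, rfl⟩ := h.toric.mem_torus_iff.1 hx
  rw [hxy.unique (h.toricHom f)]
  generalize specialize K s.Λ f = g
  induction g using AddMonoidAlgebra.induction_linear with
  | zero => simp
  | add x y hx hy =>
    rw [map_add]
    exact add_mem hx hy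
  | single c a =>
    rw [Laurent.evalHom_single]
    exact Subalgebra.smul_mem _ (prod_mem fun i _ => hzpow i _) a

end IsLimitSeed

theorem isLimitSeed_initial {K : Type*} [Field K] {r n : ℕ}
    {Λ : Matrix (Fin (r + n)) (Fin (r + n)) ℤ} {B : Matrix (Fin (r + n)) (Fin r) ℤ}
    (h : IsCompatiblePair Λ B) : IsLimitSeed (initialQuantumSeed K Λ B) (initialSeed K B) where
  toric :=
    { skew := h.skew
      ne_zero := fun i => numerator_ne_zero (ne_zero_of_specialize (by
        rw [specialize_X]
        exact Laurent.X_ne_zero i))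
      comm := fun i j => by
        have hmul : QuantumTorus.X K Λ (Pi.single i 1) * QuantumTorus.X K Λ (Pi.single j 1) =
            algebraMap (QRing K) (QuantumTorus K Λ) (qHalf K (2 * Λ i j)) *
              (QuantumTorus.X K Λ (Pi.single j 1) * QuantumTorus.X K Λ (Pi.single i 1)) := by
          rw [← Algebra.smul_def, X_mul_X, X_mul_X, smul_smul, ← qHalf_add, form_single,
            form_single, h.skew j i, add_comm (Pi.single j 1)]
          congr 2
          ring
        have := congrArg (OreLocalization.numeratorRingHom (S := (QuantumTorus K Λ)⁰)) hmul
        rw [map_mul, map_mul, map_mul] at this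
        unfold QComm
        rw [Algebra.smul_def]
        exact this }
  compatible := h
  B_eq := rfl
  specializesTo i := by
    have := SpecializesTo.numerator (QuantumTorus.X K Λ (Pi.single i 1))
    rw [specialize_X] at this
    exact this
  generates := Seed.generates_initialSeed B

/-! ### Base change to `q = 1` -/

section BaseChange

variable {K : Type*} [Field K] {T : Type*} [Ring T] [Algebra (QRing K) T]

theorem exists_eq_one_tmul (z : K₁ K ⊗[QRing K] T) : ∃ t : T, z = 1 ⊗ₜ t := by
  induction z using TensorProduct.induction_on with
  | zero => exact ⟨0, (TensorProduct.tmul_zero _ _).symm⟩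
  | add x y hx hy =>
    obtain ⟨t, rfl⟩ := hx
    obtain ⟨u, rfl⟩ := hy
    exact ⟨t + u, (TensorProduct.tmul_add _ _ _).symm⟩
  | tmul a t =>
    obtain ⟨a, rfl⟩ := Ideal.Quotient.mk_surjective a
    refine ⟨a • t, ?_⟩
    rw [← TensorProduct.smul_tmul, ← Algebra.algebraMap_eq_smul_one]
    rfl

theorem one_tmul_smul_eq_zero (t : T) : (1 : K₁ K) ⊗ₜ[QRing K] ((qHalf K 1 - 1) • t) = 0 := by
  rw [← TensorProduct.smul_tmul, ← Algebra.algebraMap_eq_smul_one]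
  have : algebraMap (QRing K) (K₁ K) (qHalf K 1 - 1) = 0 :=
    Ideal.Quotient.eq_zero_iff_mem.2 (Ideal.mem_span_singleton_self _)
  rw [this, TensorProduct.zero_tmul]

/-- Every tensor has the form 1 ⊗ t, and it vanishes for t in pT. Surjectivity of ψ and a kernel
contained in pT are therefore enough. -/
theorem exists_baseChange_equiv {C : Type*} [CommRing C] [Algebra K C] (ψ : T →+* C)
    (hψ : ∀ a t, ψ (a • t) = evalOne K a • ψ t) (hsurj : Function.Surjective ψ)
    (hker : ∀ t, ψ t = 0 → ∃ u, t = (qHalf K 1 - 1) • u) :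
    ∃ θ : K₁ K ⊗[QRing K] T ≃ₐ[K] C, ∀ t, θ (1 ⊗ₜ t) = ψ t := by
  let _ : Algebra (QRing K) C := ((algebraMap K C).comp (evalOne K)).toAlgebra
  have halg : ∀ a : QRing K, algebraMap (QRing K) C a = algebraMap K C (evalOne K a) := fun _ => rfl
  let f : K₁ K →ₐ[QRing K] C := Ideal.Quotient.liftₐ _ (Algebra.ofId (QRing K) C) (by
    intro a ha
    obtain ⟨b, rfl⟩ := Ideal.mem_span_singleton.1 ha
    rw [Algebra.ofId_apply, halg, map_mul, map_sub, evalOne_qHalf, map_one, sub_self, zero_mul,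
      map_zero])
  let g : T →ₐ[QRing K] C := AlgHom.mk' ψ fun a t => by
    rw [hψ, Algebra.smul_def, Algebra.smul_def, halg]
  let θ := Algebra.TensorProduct.lift f g fun _ _ => mul_comm _ _
  have htmul : ∀ a t, θ (a ⊗ₜ t) = f a * g t :=
    fun a t => Algebra.TensorProduct.lift_tmul f g _ a t
  have hθ : ∀ t, θ (1 ⊗ₜ t) = ψ t := fun t => by
    rw [htmul, map_one, one_mul]
    rfl
  let θ' : K₁ K ⊗[QRing K] T →ₐ[K] C :=
    { θ.toRingHom with
      commutes' := fun a => by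
        change θ (algebraMap K (K₁ K) a ⊗ₜ 1) = _
        rw [htmul, map_one, mul_one]
        have : algebraMap K (K₁ K) a = algebraMap (QRing K) (K₁ K) (algebraMap K (QRing K) a) := rfl
        rw [this, AlgHom.commutes, halg, evalOne_algebraMap] }
  refine ⟨AlgEquiv.ofBijective θ' ⟨(injective_iff_map_eq_zero _).2 fun z hz => ?_, fun c => ?_⟩,
    hθ⟩
  · obtain ⟨t, rfl⟩ := exists_eq_one_tmul z
    obtain ⟨u, rfl⟩ := hker t ((hθ t).symm.trans hz)
    exact one_tmul_smul_eq_zero u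
  · obtain ⟨t, rfl⟩ := hsurj c
    exact ⟨_, hθ t⟩

end BaseChange

theorem evalHom_initialSeed {K : Type*} [Field K] {r n : ℕ} (B : Matrix (Fin (r + n)) (Fin r) ℤ)
    (hx : ∀ i, (initialSeed K B).x i ≠ 0) (f : Laurent K (r + n)) :
    Laurent.evalHom K (initialSeed K B).x hx f =
      algebraMap (Laurent K (r + n)) (RatField K (r + n)) f := by
  obtain ⟨N, P, hP⟩ := Laurent.exists_aeval_eq f
  have h : (Laurent.evalHom K (initialSeed K B).x hx).comp (MvPolynomial.aeval (Laurent.X K)) =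
      (IsScalarTower.toAlgHom K (Laurent K (r + n)) (RatField K (r + n))).comp
        (MvPolynomial.aeval (Laurent.X K)) := by
    ext i
    simp only [AlgHom.comp_apply, MvPolynomial.aeval_X, Laurent.evalHom_X]
    rfl
  have h1 := DFunLike.congr_fun h P
  have h2 := DFunLike.congr_fun h (∏ i, MvPolynomial.X i)
  simp only [AlgHom.comp_apply, ← hP, map_prod, MvPolynomial.aeval_X] at h1 h2
  rw [map_mul, map_mul, map_pow, map_pow, map_prod, h2, map_prod] at h1
  refine mul_left_cancel₀ (pow_ne_zero N (Finset.prod_ne_zero_iff.2 fun i _ => ?_)) h1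
  exact hx i

/-- The specialization `T_qM → K[X₁^{±1}, …, X_m^{±1}]` of the initial torus. -/
theorem exists_specialize_torus {K : Type*} [Field K] {r n : ℕ}
    {Λ : Matrix (Fin (r + n)) (Fin (r + n)) ℤ} {B : Matrix (Fin (r + n)) (Fin r) ℤ}
    (h : IsLimitSeed (initialQuantumSeed K Λ B) (initialSeed K B)) :
    ∃ ψ : (initialQuantumSeed K Λ B).torus K →+* Laurent K (r + n),
      (∀ a t, ψ (a • t) = evalOne K a • ψ t) ∧ Function.Surjective ψ ∧
      (∀ t, ψ t = 0 → ∃ u, t = (qHalf K 1 - 1) • u) ∧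
      (∀ t, SpecializesTo t.1 (algebraMap (Laurent K (r + n)) (RatField K (r + n)) (ψ t))) := by
  let e : QuantumTorus K (initialQuantumSeed K Λ B).Λ ≃ₐ[QRing K] (initialQuantumSeed K Λ B).torus K :=
    (AlgEquiv.ofInjective h.toric.toricHom h.toricHom_injective).trans
      (Subalgebra.equivOfEq _ _ h.toric.range_toricHom)
  have he : ∀ f, (e f).1 = h.toric.toricHom f := fun f => rfl
  refine ⟨(specialize K (initialQuantumSeed K Λ B).Λ).comp (RingHomClass.toRingHom e.symm), fun a t => ?_, fun f => ?_, fun t ht => ?_,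
    fun t => ?_⟩
  · exact (congrArg _ (map_smul e.symm a t)).trans (specialize_smul _ _)
  · induction f using AddMonoidAlgebra.induction_linear with
    | zero => exact ⟨0, map_zero _⟩
    | add f g hf hg =>
      obtain ⟨x, rfl⟩ := hf
      obtain ⟨y, rfl⟩ := hg
      exact ⟨x + y, map_add _ _ _⟩
    | single c a =>
      refine ⟨e (mono _ c (algebraMap K (QRing K) a)), ?_⟩
      rw [RingHom.comp_apply]
      refine (congrArg _ (e.symm_apply_apply _)).trans ?_
      rw [specialize_mono, evalOne_algebraMap]
  · obtain ⟨y, hy⟩ := exists_eq_smul_of_specialize_eq_zero ht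
    refine ⟨e y, ?_⟩
    rw [← map_smul, ← hy]
    exact (e.apply_symm_apply t).symm
  · obtain ⟨f, rfl⟩ := e.surjective t
    have h1 := h.toricHom f
    rw [evalHom_initialSeed, ← he] at h1
    rw [RingHom.comp_apply]
    convert h1
    exact e.symm_apply_apply f

theorem inv_frozen_mem_upper {K : Type*} [Field K] {F : Type*} [DivisionRing F]
    [Algebra (QRing K) F] {r n : ℕ} (s : QuantumSeed F r n) (j : Fin n) :
    (s.x (Fin.natAdd r j))⁻¹ ∈ s.upper K := by
  rw [QuantumSeed.upper, Algebra.mem_inf, Algebra.mem_iInf]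
  refine ⟨QuantumSeed.x_inv_mem_torus _, fun k => ?_⟩
  rw [← QuantumSeed.mutate_x_of_ne (K := K) (s := s) (k := k) (i := Fin.natAdd r j)]
  · exact QuantumSeed.x_inv_mem_torus _
  · intro h
    have := congrArg Fin.val h
    simp only [Fin.val_natAdd, Fin.val_castAdd] at this
    omega

end QCA

end

/-! ### Comparison with the classical cluster algebras -/

theorem corollary3p6 {K : Type*} [Field K] [CharZero K] {r n : ℕ}
    (Λ : Matrix (Fin (r + n)) (Fin (r + n)) ℤ) (B : Matrix (Fin (r + n)) (Fin r) ℤ)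
    (hΛB : QCA.IsCompatiblePair Λ B) :
    let s := QCA.initialQuantumSeed K Λ B
    let j₁ : QCA.K₁ K ⊗[QCA.QRing K] s.upper K →ₐ[QCA.QRing K] QCA.K₁ K ⊗[QCA.QRing K] s.torus K :=
      Algebra.TensorProduct.map (AlgHom.id (QCA.QRing K) (QCA.K₁ K)) (s.upperIncl K)
    s.upper K = ⨅ (s' : QCA.QuantumSeed (QCA.QuantumField K Λ) r n)
        (_ : QCA.QuantumSeed.MutationEquiv K s s'), s'.torus K ∧
    Function.Injective j₁ ∧
    ∃ θ : QCA.K₁ K ⊗[QCA.QRing K] s.torus K ≃ₐ[K] QCA.Laurent K (r + n),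
      (∀ i, θ (1 ⊗ₜ s.torusVar K i) = QCA.Laurent.X K i) ∧
      (QCA.clusterA K B : Set (QCA.RatField K (r + n))) ⊆
        Set.range (fun z => algebraMap (QCA.Laurent K (r + n)) _ (θ (j₁ z))) ∧
      Set.range (fun z => algebraMap (QCA.Laurent K (r + n)) (QCA.RatField K (r + n)) (θ (j₁ z))) ⊆
        QCA.clusterU K B := by

  intro s j₁
  have h := QCA.isLimitSeed_initial (K := K) hΛB
  obtain ⟨ψ, hψ, hsurj, hker, hspec⟩ := QCA.exists_specialize_torus h
  obtain ⟨θ, hθ⟩ := QCA.exists_baseChange_equiv ψ hψ hsurj hker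
  have hj : ∀ u : s.upper K, j₁ (1 ⊗ₜ u) = 1 ⊗ₜ s.upperIncl K u := fun u => rfl
  have hinj : Function.Injective (algebraMap (QCA.Laurent K (r + n)) (QCA.RatField K (r + n))) :=
    IsFractionRing.injective _ _
  have hrange : ∀ u : s.upper K, ∀ y, QCA.SpecializesTo u.1 y →
      algebraMap (QCA.Laurent K (r + n)) (QCA.RatField K (r + n)) (θ (j₁ (1 ⊗ₜ u))) = y := by
    intro u y hy
    rw [hj, hθ]
    exact (hspec (s.upperIncl K u)).unique hy
  refine ⟨h.upper_eq_iInf, (injective_iff_map_eq_zero _).2 fun z hz => ?_, θ, fun i => ?_, ?_, ?_⟩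
  -- Here u = p t with t in the initial torus, so t is regular at q = 1. Saturation of the
  -- neighbouring tori puts t in the upper algebra, and 1 ⊗ u vanishes already there.
  · obtain ⟨u, rfl⟩ := QCA.exists_eq_one_tmul z
    obtain ⟨t, ht⟩ := hker (s.upperIncl K u) (by rw [← hθ, ← hj, hz, map_zero])
    have ht' : u.1 = (QCA.qHalf K 1 - 1) • t.1 := congrArg Subtype.val ht
    have hu := QCA.IsLimitSeed.mem_upper.1 u.2
    have htU : t.1 ∈ s.upper K := QCA.IsLimitSeed.mem_upper.2 ⟨t.2, fun k =>
      (h.mutate k).mem_torus_of_smul_mem (hspec t) (ht' ▸ hu.2 k)⟩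
    have : u = (QCA.qHalf K 1 - 1) • (⟨t.1, htU⟩ : s.upper K) := Subtype.ext ht'
    rw [this]
    exact QCA.one_tmul_smul_eq_zero _
  · rw [hθ]
    apply hinj
    exact (hspec (s.torusVar K i)).unique (h.specializesTo i)
  -- The image is a K-subalgebra, so only the generators of the cluster algebra have to be reached.
  · let A : Subalgebra K (QCA.RatField K (r + n)) :=
      { carrier := Set.range fun z => algebraMap (QCA.Laurent K (r + n))
          (QCA.RatField K (r + n)) (θ (j₁ z))
        mul_mem' := by
          rintro _ _ ⟨x, rfl⟩ ⟨y, rfl⟩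
          exact ⟨x * y, by simp only [map_mul]⟩
        add_mem' := by
          rintro _ _ ⟨x, rfl⟩ ⟨y, rfl⟩
          exact ⟨x + y, by simp only [map_add]⟩
        algebraMap_mem' := fun a => by
          refine ⟨1 ⊗ₜ algebraMap (QCA.QRing K) (s.upper K) (algebraMap K (QCA.QRing K) a), ?_⟩
          refine hrange _ _ ?_
          have := QCA.SpecializesTo.of_algebraMap (Λ := Λ) (algebraMap K (QCA.QRing K) a)
          rwa [QCA.evalOne_algebraMap] at this }
    change QCA.clusterA K B ≤ A
    refine Algebra.adjoin_le ?_
    rintro _ (⟨t', ht', i, rfl⟩ | ⟨j, rfl⟩)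
    · obtain ⟨s', hs', h'⟩ := h.exists_of_seed_mutationEquiv ht'
      exact ⟨1 ⊗ₜ ⟨s'.x i, hs' ▸ h'.x_mem_upper i⟩, hrange _ _ (h'.specializesTo i)⟩
    · exact ⟨1 ⊗ₜ ⟨(s.x (Fin.natAdd r j))⁻¹, QCA.inv_frozen_mem_upper s j⟩,
        hrange _ _ ((h.specializesTo _).inv (h.generates.ne_zero _))⟩
  · rintro _ ⟨z, rfl⟩
    obtain ⟨u, rfl⟩ := QCA.exists_eq_one_tmul z
    have hu : QCA.SpecializesTo u.1 (algebraMap (QCA.Laurent K (r + n)) (QCA.RatField K (r + n))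
        (θ (j₁ (1 ⊗ₜ u)))) := by
      rw [hj, hθ]
      exact hspec (s.upperIncl K u)
    change _ ∈ QCA.clusterU K B
    simp only [QCA.clusterU, QCA.Seed.upper, Algebra.mem_iInf]
    intro t' ht'
    -- By invariance u lies in the torus of the lifted seed, so its value lies in the Laurent ring
    -- of `t'`.
    obtain ⟨s', hs', h'⟩ := h.exists_of_seed_mutationEquiv ht'
    refine h'.specializesTo_mem_torus hu ?_
    have : u.1 ∈ s'.upper K := by
      rw [hs']
      exact u.2
    exact (QCA.IsLimitSeed.mem_upper.1 this).1
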